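/- **Kolmogorov-type chargeability theorem.** Let $d\ge 1$ be an integer and write $|A|$ for the Lebesgue measure of $A\subset\mathbb R^d$. *Definitions.* For an integrable $u:\mathbb R^d\to\mathbb R$ let $\|Du\|(\mathbb R^d)=\sup\{\int u\,\mathrm{div}\,\varphi:\varphi\in C^1_c(\mathbb R^d;\mathbb R^d),\ |\varphi|\le 1\}$. Let $BV([0,1]^d)$ be the space of (classes of) integrable functions $u$ on $\mathbb R^d$ that vanish a.e. outside $[0,1]^d$ and satisfy $\|Du\|(\mathbb R^d)<\infty$, with norm $\|u\|_{BV}=\|u\|_{1}+\|Du\|(\mathbb R^d)$. For $f\in L^d([0,1]^d)$ let $T_f\in BV([0,1]^d)^*$ be $T_f(u)=\int_{[0,1]^d}fu$, and let $SCH([0,1]^d)$ be the norm closure of $\{T_f: f\in L^d([0,1]^d)\}$ in $BV([0,1]^d)^*$. A $BV$-subset of $[0,1]^d$ is a measurable $B\subset[0,1]^d$ with $\|B\|:=\|D\mathbf 1_B\|(\mathbb R^d)<\infty$. A charge is a real function $\mu$ of the $BV$-subsets of $[0,1]^d$ such that $\mu(B_1\cup B_2)=\mu(B_1)+\mu(B_2)$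 whenever $|B_1\cap B_2|=0$, and $\mu(B_n)\to\mu(B)$ whenever $\sup_n\|B_n\|<\infty$ and $|B_n\,\triangle\, B|\to0$. A charge $\mu$ is strong if there is $\alpha\in SCH([0,1]^d)$ with $\mu(B)=\alpha(\mathbf 1_B)$ for all $BV$-subsets $B$ of $[0,1]^d$. For a continuous $f:[0,1]^d\to\mathbb R$ and a rectangle $K=\prod_i[a_i,b_i]\subset[0,1]^d$ with $a_i<b_i$, let $$\Delta_fK=\sum_{c\in\prod_i\{a_i,b_i\}}(-1)^{\#\{i\,:\,c_i=a_i\}}f(c);$$ $\Delta_f$ is extended by $\Delta_f(K_1\cup\dots\cup K_p)=\sum_j\Delta_fK_j$ to finite unions of pairwise almost disjoint rectangles. A dyadic cube is a set $\prod_{i=1}^d[2^{-n}k_i,2^{-n}(k_i+1)]$ with integers $n\ge0$ and $0\le k_i\le 2^n-1$. For $\frac{d-1}d<\gamma<1$, the function $f$ is called $\gamma$-Hölder strongly chargeable if $\Delta_f$ extends to a strong charge $\mu$ for which there is $C'\ge0$ with $|\mu(K)|\le C'|K|^\gamma$ for all dyadic cubes $K$. *Theorem.* Let $X=(X_t)_{t\in[0,1]^d}$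 be a real-valued random process on a probability space with continuous sample paths. Let $q>0$, $C\ge0$, $\delta>0$ satisfy $$\frac{d-1}{d}<\frac{\delta}{q}\le 1\qquad\text{and}\qquad \mathbb E\big(|\Delta_XK|^q\big)\le C|K|^{1+\delta}\ \text{ for all dyadic cubes }K.$$ Then almost surely, for every $\gamma$ with $\frac{d-1}{d}<\gamma<\frac{\delta}{q}$, the sample path of $X$ is $\gamma$-Hölder strongly chargeable. -/

import Mathlib

open MeasureTheory Filter Topology
open scoped ENNReal symmDiff

noncomputable section

namespace StrongCharge

/-! ### Variation, functions of bounded variation -/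

/-- The Euclidean space `ℝ^d`, with Euclidean norm and Lebesgue measure. -/
abbrev Space (d : ℕ) : Type := EuclideanSpace ℝ (Fin d)

/-- The closed unit cube `[0,1]^d`, as a subset of `ℝ^d`. -/
def cube (d : ℕ) : Set (Space d) := {x | ∀ i, 0 ≤ x i ∧ x i ≤ 1}

/-- The divergence of a vector field on `ℝ^d`. -/
def divergence {d : ℕ} (φ : Space d → Space d) (x : Space d) : ℝ :=
  ∑ i, (fderiv ℝ φ x (EuclideanSpace.single i 1)) i

/-- Admissible fields in the definition of the variation: `C¹`, compactly supported, with
Euclidean norm at most `1` everywhere. -/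
structure IsTestField {d : ℕ} (φ : Space d → Space d) : Prop where
  contDiff : ContDiff ℝ 1 φ
  hasCompactSupport : HasCompactSupport φ
  norm_le_one : ∀ x, ‖φ x‖ ≤ 1

/-- The variation `‖Du‖(ℝ^d)` of an integrable function `u` on `ℝ^d`. -/
def variation {d : ℕ} (u : Space d → ℝ) : ℝ≥0∞ :=
  ⨆ (φ : Space d → Space d) (_ : IsTestField φ), ENNReal.ofReal (∫ x, u x * divergence φ x)

section VariationLemmas

variable {d : ℕ}

lemma IsTestField.neg {φ : Space d → Space d} (h : IsTestField φ) :
    IsTestField (fun x => - φ x) :=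
  ⟨h.contDiff.neg, h.hasCompactSupport.comp_left (g := fun y => - y) neg_zero,
    fun x => by simpa using h.norm_le_one x⟩

lemma divergence_neg (φ : Space d → Space d) (x : Space d) :
    divergence (fun y => - φ y) x = - divergence φ x := by
  simp [divergence, fderiv_fun_neg]

lemma IsTestField.continuous_divergence {φ : Space d → Space d} (h : IsTestField φ) :
    Continuous (divergence φ) := by
  have h1 : Continuous (fderiv ℝ φ) := h.contDiff.continuous_fderiv one_ne_zero
  refine continuous_finsetSum _ fun i _ => ?_
  exact (EuclideanSpace.proj i : Space d →L[ℝ] ℝ).continuous.comp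
    (h1.clm_apply continuous_const)

lemma IsTestField.hasCompactSupport_divergence {φ : Space d → Space d} (h : IsTestField φ) :
    HasCompactSupport (divergence φ) := by
  have h1 : HasCompactSupport (fderiv ℝ φ) := h.hasCompactSupport.fderiv ℝ
  exact h1.comp_left
    (g := fun L : Space d →L[ℝ] Space d => ∑ i, (L (EuclideanSpace.single i 1)) i) (by simp)

lemma IsTestField.integrable_mul {φ : Space d → Space d} (h : IsTestField φ) {u : Space d → ℝ}
    (hu : Integrable u) : Integrable (fun x => u x * divergence φ x) := by
  obtain ⟨C, hC⟩ := h.hasCompactSupport_divergence.exists_bound_of_continuous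
    h.continuous_divergence
  exact hu.mul_bdd h.continuous_divergence.aestronglyMeasurable (Eventually.of_forall hC)

lemma IsTestField.abs_integral_le {φ : Space d → Space d} (h : IsTestField φ)
    (u : Space d → ℝ) :
    ENNReal.ofReal |∫ x, u x * divergence φ x| ≤ variation u := by
  rcases le_total 0 (∫ x, u x * divergence φ x) with h0 | h0
  · rw [abs_of_nonneg h0]
    exact le_iSup₂_of_le φ h le_rfl
  · rw [abs_of_nonpos h0]
    refine le_iSup₂_of_le _ h.neg ?_
    simp [divergence_neg, integral_neg]

lemma variation_congr {u v : Space d → ℝ} (h : u =ᵐ[volume] v) : variation u = variation v := by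
  refine iSup_congr fun φ => iSup_congr fun _ => congrArg ENNReal.ofReal (integral_congr_ae ?_)
  filter_upwards [h] with x hx
  rw [hx]

lemma variation_zero : variation (fun _ : Space d => (0 : ℝ)) = 0 := by
  simp [variation]

lemma variation_add_le {u v : Space d → ℝ} (hu : Integrable u) (hv : Integrable v) :
    variation (fun x => u x + v x) ≤ variation u + variation v := by
  refine iSup₂_le fun φ hφ => ?_
  simp only [add_mul]
  rw [integral_add (hφ.integrable_mul hu) (hφ.integrable_mul hv)]
  refine ENNReal.ofReal_add_le.trans (add_le_add ?_ ?_)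
  · exact le_iSup₂_of_le φ hφ le_rfl
  · exact le_iSup₂_of_le φ hφ le_rfl

lemma variation_sum_le {ι : Type*} (s : Finset ι) {u : ι → Space d → ℝ}
    (hu : ∀ i, Integrable (u i)) :
    variation (fun x => ∑ i ∈ s, u i x) ≤ ∑ i ∈ s, variation (u i) := by
  classical
  induction s using Finset.induction_on with
  | empty => simp [variation_zero]
  | insert a s ha ih =>
    simp only [Finset.sum_insert ha]
    exact (variation_add_le (hu a) (integrable_finsetSum s fun i _ => hu i)).trans
      (add_le_add le_rfl ih)

lemma variation_smul_le (c : ℝ) (u : Space d → ℝ) :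
    variation (fun x => c * u x) ≤ ENNReal.ofReal |c| * variation u := by
  refine iSup₂_le fun φ hφ => ?_
  simp only [mul_assoc, integral_const_mul]
  calc ENNReal.ofReal (c * ∫ x, u x * divergence φ x)
      ≤ ENNReal.ofReal (|c| * |∫ x, u x * divergence φ x|) := by
        rw [← abs_mul]
        exact ENNReal.ofReal_le_ofReal (le_abs_self _)
    _ = ENNReal.ofReal |c| * ENNReal.ofReal |∫ x, u x * divergence φ x| :=
        ENNReal.ofReal_mul (abs_nonneg c)
    _ ≤ _ := by gcongr; exact hφ.abs_integral_le u

end VariationLemmas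

/-- The functions of `BV(ℝ^d)` that vanish almost everywhere outside `[0,1]^d`, as a subspace
of `L¹(ℝ^d)`. -/
def bvSubmodule (d : ℕ) : Submodule ℝ (Lp ℝ 1 (volume : Measure (Space d))) where
  carrier := {u | (∀ᵐ x, x ∉ cube d → u x = 0) ∧ variation u < ∞}
  zero_mem' := by
    have h : (⇑(0 : Lp ℝ 1 (volume : Measure (Space d)))) =ᵐ[volume] fun _ => (0 : ℝ) :=
      Lp.coeFn_zero _ _ _
    refine ⟨?_, ?_⟩
    · filter_upwards [h] with x hx _ using hx
    · rw [variation_congr h, variation_zero]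
      exact ENNReal.zero_lt_top
  add_mem' := by
    rintro u v ⟨hu, hu'⟩ ⟨hv, hv'⟩
    refine ⟨?_, ?_⟩
    · filter_upwards [hu, hv, Lp.coeFn_add u v] with x h1 h2 h3 hx
      have h4 : (u + v) x = u x + v x := h3
      rw [h4, h1 hx, h2 hx, add_zero]
    · have h : (⇑(u + v)) =ᵐ[volume] fun x => u x + v x := Lp.coeFn_add u v
      rw [variation_congr h]
      exact (variation_add_le (L1.integrable_coeFn u) (L1.integrable_coeFn v)).trans_lt
        (ENNReal.add_lt_top.2 ⟨hu', hv'⟩)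
  smul_mem' := by
    rintro c u ⟨hu, hu'⟩
    refine ⟨?_, ?_⟩
    · filter_upwards [hu, Lp.coeFn_smul c u] with x h1 h3 hx
      simp [h3, h1 hx]
    · have h : (⇑(c • u)) =ᵐ[volume] fun x => c * u x := Lp.coeFn_smul c u
      rw [variation_congr h]
      exact (variation_smul_le c u).trans_lt (ENNReal.mul_lt_top ENNReal.ofReal_lt_top hu')

/-- The space `BV([0,1]^d)`. It carries the norm `‖u‖_{BV} = ‖u‖₁ + ‖Du‖(ℝ^d)` defined below,
not the norm of `L¹`. -/
def BV (d : ℕ) : Type := bvSubmodule d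

instance (d : ℕ) : AddCommGroup (BV d) := inferInstanceAs (AddCommGroup (bvSubmodule d))

instance (d : ℕ) : Module ℝ (BV d) := inferInstanceAs (Module ℝ (bvSubmodule d))

/-- The underlying class in `L¹(ℝ^d)` of an element of `BV([0,1]^d)`. -/
def BV.toL1 {d : ℕ} : BV d →ₗ[ℝ] Lp ℝ 1 (volume : Measure (Space d)) := (bvSubmodule d).subtype

instance (d : ℕ) : Norm (BV d) := ⟨fun u => ‖u.toL1‖ + (variation u.toL1).toReal⟩

lemma BV.norm_def {d : ℕ} (u : BV d) : ‖u‖ = ‖u.toL1‖ + (variation u.toL1).toReal := rfl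

lemma BV.variation_ne_top {d : ℕ} (u : BV d) : variation u.toL1 ≠ ∞ := u.2.2.ne

lemma BV.toL1_injective {d : ℕ} : Function.Injective (BV.toL1 (d := d)) :=
  Subtype.val_injective

lemma BV.norm_smul_le {d : ℕ} (c : ℝ) (u : BV d) : ‖c • u‖ ≤ ‖c‖ * ‖u‖ := by
  rw [BV.norm_def, BV.norm_def, map_smul, norm_smul, mul_add]
  gcongr
  have h : (⇑(c • u.toL1)) =ᵐ[volume] fun x => c * u.toL1 x := Lp.coeFn_smul c u.toL1
  rw [variation_congr h]
  have h2 := ENNReal.toReal_mono (ENNReal.mul_ne_top ENNReal.ofReal_ne_top u.variation_ne_top)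
    (variation_smul_le c u.toL1)
  rwa [ENNReal.toReal_mul, ENNReal.toReal_ofReal (abs_nonneg c)] at h2

instance (d : ℕ) : NormedAddCommGroup (BV d) :=
  AddGroupNorm.toNormedAddCommGroup
    { toFun := fun u => ‖u‖
      map_zero' := by
        have h : (⇑(0 : Lp ℝ 1 (volume : Measure (Space d)))) =ᵐ[volume] fun _ => (0 : ℝ) :=
          Lp.coeFn_zero _ _ _
        rw [BV.norm_def, map_zero, variation_congr h, variation_zero]
        simp
      add_le' := by
        intro u v
        rw [BV.norm_def, BV.norm_def, BV.norm_def, map_add]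
        have h : (⇑(u.toL1 + v.toL1)) =ᵐ[volume] fun x => u.toL1 x + v.toL1 x :=
          Lp.coeFn_add _ _
        have h2 := ENNReal.toReal_mono
          (ENNReal.add_ne_top.2 ⟨u.variation_ne_top, v.variation_ne_top⟩)
          (variation_add_le (L1.integrable_coeFn u.toL1) (L1.integrable_coeFn v.toL1))
        rw [ENNReal.toReal_add u.variation_ne_top v.variation_ne_top] at h2
        rw [variation_congr h]
        have h3 := norm_add_le u.toL1 v.toL1
        linarith
      neg' := by
        have key : ∀ u : BV d, ‖-u‖ ≤ ‖u‖ := fun u => by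
          simpa using BV.norm_smul_le (-1) u
        intro u
        exact le_antisymm (key u) (by simpa using key (-u))
      eq_zero_of_map_eq_zero' := by
        intro u hu
        have hu' : ‖u.toL1‖ + (variation u.toL1).toReal = 0 := hu
        have h1 : ‖u.toL1‖ = 0 := by
          have := norm_nonneg u.toL1
          have := ENNReal.toReal_nonneg (a := variation u.toL1)
          linarith
        apply BV.toL1_injective
        rw [map_zero]
        exact norm_eq_zero.1 h1 }

instance (d : ℕ) : NormedSpace ℝ (BV d) := ⟨BV.norm_smul_le⟩

/-! ### Strong charge functionals -/

/-- The range of `T : L^d([0,1]^d) → BV([0,1]^d)^*`, `T_f(u) = ∫_{[0,1]^d} f u`. -/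
def rangeT (d : ℕ) : Set (StrongDual ℝ (BV d)) :=
  {α | ∃ f : Space d → ℝ, MemLp f d (volume.restrict (cube d)) ∧
    ∀ u : BV d, IntegrableOn (fun x => f x * u.toL1 x) (cube d) ∧
      α u = ∫ x in cube d, f x * u.toL1 x}

/-- The space `SCH([0,1]^d)` of strong charge functionals: the norm closure of the range of `T`
in the dual of `BV([0,1]^d)`. -/
def SCH (d : ℕ) : Set (StrongDual ℝ (BV d)) := closure (rangeT d)

/-! ### `BV`-sets and charges -/

/-- The perimeter `‖A‖ = ‖D 1_A‖(ℝ^d)`. -/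
def perimeter {d : ℕ} (A : Set (Space d)) : ℝ≥0∞ := variation (A.indicator fun _ => (1 : ℝ))

/-- The `BV`-subsets of `[0,1]^d`: Lebesgue measurable subsets with finite perimeter. -/
structure BVSet (d : ℕ) where
  carrier : Set (Space d)
  subset_cube : carrier ⊆ cube d
  nullMeasurableSet : NullMeasurableSet carrier
  perimeter_lt_top : perimeter carrier < ∞

lemma cube_eq_preimage (d : ℕ) :
    cube d = (WithLp.ofLp : Space d → (Fin d → ℝ)) ⁻¹' Set.Icc 0 1 := by
  ext x
  simp [cube, Pi.le_def, forall_and]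

lemma volume_cube_lt_top (d : ℕ) : volume (cube d) < ∞ := by
  rw [cube_eq_preimage, (PiLp.volume_preserving_ofLp (Fin d)).measure_preimage
    measurableSet_Icc.nullMeasurableSet]
  exact isCompact_Icc.measure_lt_top

lemma integrable_indicator {d : ℕ} {A : Set (Space d)} (hA : A ⊆ cube d)
    (hm : NullMeasurableSet A) : Integrable (A.indicator fun _ => (1 : ℝ)) := by
  have hc : MeasurableSet (cube d) := by
    rw [cube_eq_preimage]
    exact (PiLp.volume_preserving_ofLp (Fin d)).measurable measurableSet_Icc
  have h : Integrable ((cube d).indicator fun _ => (1 : ℝ)) :=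
    (integrable_indicator_iff hc).2 (integrableOn_const (volume_cube_lt_top d).ne)
  refine h.mono (aestronglyMeasurable_const.indicator₀ hm) (Eventually.of_forall fun x => ?_)
  by_cases hx : x ∈ A
  · simp [hx, hA hx]
  · simp [hx]

/-- The indicator function of a `BV`-set, as an element of `BV([0,1]^d)`. -/
def BVSet.ind {d : ℕ} (B : BVSet d) : BV d :=
  ⟨(memLp_one_iff_integrable.2
      (integrable_indicator B.subset_cube B.nullMeasurableSet)).toLp _, by
    have h := (memLp_one_iff_integrable.2
      (integrable_indicator B.subset_cube B.nullMeasurableSet)).coeFn_toLp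
    refine ⟨?_, ?_⟩
    · filter_upwards [h] with x hx hx'
      rw [hx, Set.indicator_of_notMem fun hB => hx' (B.subset_cube hB)]
    · rw [variation_congr h]
      exact B.perimeter_lt_top⟩

/-- Charges on `[0,1]^d`: finitely additive functions of `BV`-sets that are continuous with respect
to `BV`-convergence. -/
structure IsCharge {d : ℕ} (μ : BVSet d → ℝ) : Prop where
  additive : ∀ B₁ B₂ B : BVSet d, volume (B₁.carrier ∩ B₂.carrier) = 0 →
    B.carrier = B₁.carrier ∪ B₂.carrier → μ B = μ B₁ + μ B₂
  continuous : ∀ (B : ℕ → BVSet d) (B' : BVSet d), (⨆ n, perimeter (B n).carrier) < ∞ →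
    Tendsto (fun n => volume ((B n).carrier ∆ B'.carrier)) atTop (𝓝 0) →
    Tendsto (fun n => μ (B n)) atTop (𝓝 (μ B'))

/-- Strong charges: the charges of the form `B ↦ α(1_B)` with `α` a strong charge functional. -/
def IsStrongCharge {d : ℕ} (μ : BVSet d → ℝ) : Prop :=
  IsCharge μ ∧ ∃ α ∈ SCH d, ∀ B : BVSet d, μ B = α B.ind

/-! ### Rectangles, figures, dyadic cubes and increments -/

/-- Rectangles `∏ [lo i, hi i]` with nonempty interior contained in `[0,1]^d`. -/
structure Rect (d : ℕ) where
  lo : Fin d → unitInterval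
  hi : Fin d → unitInterval
  lo_lt_hi : ∀ i, lo i < hi i

/-- The subset of `ℝ^d` underlying a rectangle. -/
def Rect.toSet {d : ℕ} (K : Rect d) : Set (Space d) :=
  {x | ∀ i, (K.lo i : ℝ) ≤ x i ∧ x i ≤ (K.hi i : ℝ)}

lemma Rect.toSet_eq_preimage {d : ℕ} (K : Rect d) :
    K.toSet = (WithLp.ofLp : Space d → (Fin d → ℝ)) ⁻¹'
      Set.Icc (fun i => (K.lo i : ℝ)) (fun i => (K.hi i : ℝ)) := by
  ext x
  simp [Rect.toSet, Pi.le_def, forall_and]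

lemma Rect.subset_cube {d : ℕ} (K : Rect d) : K.toSet ⊆ cube d :=
  fun _ hx i => ⟨(K.lo i).2.1.trans (hx i).1, (hx i).2.trans (K.hi i).2.2⟩

lemma Rect.measurableSet {d : ℕ} (K : Rect d) : MeasurableSet K.toSet := by
  rw [K.toSet_eq_preimage]
  exact (PiLp.volume_preserving_ofLp (Fin d)).measurable measurableSet_Icc

lemma Rect.perimeter_lt_top {d : ℕ} (K : Rect d) : perimeter K.toSet < ∞ := by
  rcases d with _ | n
  · have h : perimeter K.toSet = 0 := by simp [perimeter, variation, divergence]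
    rw [h]
    exact ENNReal.zero_lt_top
  set a : Fin (n + 1) → ℝ := fun i => (K.lo i : ℝ) with ha
  set b : Fin (n + 1) → ℝ := fun i => (K.hi i : ℝ) with hb
  have hab : a ≤ b := fun i => (K.lo_lt_hi i).le
  refine lt_of_le_of_lt (b := ENNReal.ofReal (∑ i : Fin (n + 1),
    (1 * volume.real (Set.Icc (a ∘ i.succAbove) (b ∘ i.succAbove)) +
      1 * volume.real (Set.Icc (a ∘ i.succAbove) (b ∘ i.succAbove))))) ?_ ENNReal.ofReal_lt_top
  refine iSup₂_le fun φ hφ => ENNReal.ofReal_le_ofReal ?_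
  have h1 : ∫ x, K.toSet.indicator (fun _ => (1 : ℝ)) x * divergence φ x =
      ∫ y in Set.Icc a b, divergence φ (WithLp.toLp 2 y) := by
    have h2 : (fun x => K.toSet.indicator (fun _ => (1 : ℝ)) x * divergence φ x) =
        K.toSet.indicator (divergence φ) := by
      ext x
      by_cases hx : x ∈ K.toSet <;> simp [hx]
    rw [h2, integral_indicator K.measurableSet, K.toSet_eq_preimage]
    exact (PiLp.volume_preserving_ofLp (Fin (n + 1))).setIntegral_preimage_emb
      (MeasurableEquiv.toLp 2 (Fin (n + 1) → ℝ)).symm.measurableEmbedding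
      (fun y => divergence φ (WithLp.toLp 2 y)) (Set.Icc a b)
  rw [h1]
  let e : (Fin (n + 1) → ℝ) →L[ℝ] Space (n + 1) :=
    ((EuclideanSpace.equiv (Fin (n + 1)) ℝ).symm : (Fin (n + 1) → ℝ) →L[ℝ] Space (n + 1))
  have he : ∀ y, e y = WithLp.toLp 2 y := fun _ => rfl
  have hφc : Continuous φ := hφ.contDiff.continuous
  have hdiv := integral_divergence_of_hasFDerivAt_off_countable' a b hab
    (fun i y => φ (e y) i)
    (fun i y => ((EuclideanSpace.proj i : Space (n + 1) →L[ℝ] ℝ).comp (fderiv ℝ φ (e y))).comp e)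
    ∅ Set.countable_empty (fun i => by fun_prop)
    (fun y _ i => by
      have h3 : HasFDerivAt φ (fderiv ℝ φ (e y)) (e y) :=
        (hφ.contDiff.differentiable one_ne_zero (e y)).hasFDerivAt
      exact ((EuclideanSpace.proj i : Space (n + 1) →L[ℝ] ℝ).hasFDerivAt.comp y
        (h3.comp y e.hasFDerivAt)))
    (by
      have h4 : Continuous (fun y => divergence φ (e y)) :=
        hφ.continuous_divergence.comp e.continuous
      exact h4.continuousOn.integrableOn_compact isCompact_Icc)
  have h5 : ∫ y in Set.Icc a b, divergence φ (WithLp.toLp 2 y) = _ := hdiv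
  rw [h5]
  have hbound : ∀ (i : Fin (n + 1)) (y : Fin (n + 1) → ℝ), ‖φ (e y) i‖ ≤ 1 := fun i y =>
    (PiLp.norm_apply_le (φ (e y)) i).trans (hφ.norm_le_one _)
  refine Finset.sum_le_sum fun i _ => ?_
  have hfin : volume (Set.Icc (a ∘ i.succAbove) (b ∘ i.succAbove)) < ∞ :=
    isCompact_Icc.measure_lt_top
  have h6 := norm_setIntegral_le_of_norm_le_const hfin
    (f := fun y => φ (e (i.insertNth (b i) y)) i) (fun y _ => hbound i _)
  have h7 := norm_setIntegral_le_of_norm_le_const hfin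
    (f := fun y => φ (e (i.insertNth (a i) y)) i) (fun y _ => hbound i _)
  rw [Real.norm_eq_abs] at h6 h7
  exact (le_abs_self _).trans ((abs_sub _ _).trans (add_le_add h6 h7))

/-- Finite unions of pairwise almost disjoint rectangles, that is, rectangular figures, are
`BV`-sets. -/
def figure {d n : ℕ} (K : Fin n → Rect d)
    (hK : Pairwise fun i j => volume ((K i).toSet ∩ (K j).toSet) = 0) : BVSet d where
  carrier := ⋃ i, (K i).toSet
  subset_cube := Set.iUnion_subset fun i => (K i).subset_cube
  nullMeasurableSet := (MeasurableSet.iUnion fun i => (K i).measurableSet).nullMeasurableSet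
  perimeter_lt_top := by
    have h0 : ∀ᵐ x : Space d, ∀ i j, i ≠ j → x ∉ (K i).toSet ∩ (K j).toSet := by
      simp only [ae_all_iff]
      exact fun i j hij => measure_eq_zero_iff_ae_notMem.1 (hK hij)
    have h1 : ((⋃ i, (K i).toSet).indicator fun _ => (1 : ℝ)) =ᵐ[volume]
        fun x => ∑ i, (K i).toSet.indicator (fun _ => (1 : ℝ)) x := by
      filter_upwards [h0] with x hx
      by_cases hxu : x ∈ ⋃ i, (K i).toSet
      · obtain ⟨i, hi⟩ := Set.mem_iUnion.1 hxu
        rw [Set.indicator_of_mem hxu, Finset.sum_eq_single i, Set.indicator_of_mem hi]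
        · intro j _ hji
          exact Set.indicator_of_notMem (fun hj => hx j i hji ⟨hj, hi⟩) _
        · simp
      · rw [Set.indicator_of_notMem hxu]
        refine (Finset.sum_eq_zero fun i _ => ?_).symm
        exact Set.indicator_of_notMem (fun hi => hxu (Set.mem_iUnion.2 ⟨i, hi⟩)) _
    unfold perimeter
    rw [variation_congr h1]
    refine (variation_sum_le _ fun i =>
      integrable_indicator (K i).subset_cube (K i).measurableSet.nullMeasurableSet).trans_lt ?_
    exact ENNReal.sum_lt_top.2 fun i _ => (K i).perimeter_lt_top

/-- A rectangle as a `BV`-set. -/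
def Rect.toBVSet {d : ℕ} (K : Rect d) : BVSet d :=
  ⟨K.toSet, K.subset_cube, K.measurableSet.nullMeasurableSet, K.perimeter_lt_top⟩

/-- The Lebesgue measure `|K|` of a rectangle. -/
def Rect.vol {d : ℕ} (K : Rect d) : ℝ := (volume : Measure (Space d)).real K.toSet

/-- The increment `Δ_f K`: the sum over the vertices `c` of `K` of `f(c)`, with one factor `-1` for
each coordinate of `c` that is a lower endpoint (the set `s` collects these coordinates). -/
def increment {d : ℕ} (f : (Fin d → unitInterval) → ℝ) (K : Rect d) : ℝ :=
  ∑ s : Finset (Fin d), (-1) ^ s.card * f (fun i => if i ∈ s then K.lo i else K.hi i)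

/-- `μ` extends the additive function `Δ_f` of figures. -/
def ExtendsIncrement {d : ℕ} (μ : BVSet d → ℝ) (f : (Fin d → unitInterval) → ℝ) : Prop :=
  ∀ (n : ℕ) (K : Fin n → Rect d)
    (hK : Pairwise fun i j => volume ((K i).toSet ∩ (K j).toSet) = 0),
    μ (figure K hK) = ∑ i, increment f (K i)

lemma dyadic_mem {n k : ℕ} (hk : k ≤ 2 ^ n) : (k : ℝ) / 2 ^ n ∈ unitInterval := by
  refine ⟨by positivity, ?_⟩
  rw [div_le_one (by positivity)]
  exact_mod_cast hk

/-- The dyadic cube `∏ [2^{-n} k_i, 2^{-n} (k_i + 1)]` of generation `n`, where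
`0 ≤ k_i ≤ 2^n - 1`. -/
def dyadicCube {d : ℕ} (n : ℕ) (k : Fin d → Fin (2 ^ n)) : Rect d where
  lo i := ⟨((k i : ℕ) : ℝ) / 2 ^ n, dyadic_mem (k i).2.le⟩
  hi i := ⟨((k i + 1 : ℕ) : ℝ) / 2 ^ n, dyadic_mem (k i).2⟩
  lo_lt_hi i := by
    rw [Subtype.mk_lt_mk]
    gcongr
    exact Nat.lt_succ_self _

/-- A strong charge is `γ`-Hölder if `|μ(K)| ≤ C |K|^γ` for all dyadic cubes `K`. -/
def IsHolder {d : ℕ} (γ : ℝ) (μ : BVSet d → ℝ) : Prop :=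
  ∃ C : ℝ, 0 ≤ C ∧ ∀ (n : ℕ) (k : Fin d → Fin (2 ^ n)),
    |μ (dyadicCube n k).toBVSet| ≤ C * (dyadicCube n k).vol ^ γ

/-- A continuous function `f` on `[0,1]^d` is `γ`-Hölder strongly chargeable if `Δ_f` extends to a
`γ`-Hölder strong charge. -/
def IsHolderStronglyChargeable {d : ℕ} (γ : ℝ) (f : (Fin d → unitInterval) → ℝ) : Prop :=
  ∃ μ : BVSet d → ℝ, IsStrongCharge μ ∧ ExtendsIncrement μ f ∧ IsHolder γ μ

end StrongCharge

end

open StrongCharge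

/-!
On each dyadic cell `Q` of generation `n` put the constant density `Δ_f Q / |Q|`, and let `T_n` be
integration against this step function, an element of the range of `T`. The density of generation
`n` is the block average of the density `G` of generation `n + 1`, so `T_{n+1} - T_n` integrates
against averages of differences between `G`, restricted to a parity class of cells, and its
translates by vectors `v` of length at most `√d / 2^{n+1}`. Translating a bounded function by `v`
changes its pairing with `u` by at most `sup |G| ‖v‖ ‖Du‖`. If `|Δ_f Q| ≤ c |Q|^γ`, then
`‖T_{n+1} - T_n‖` is of order `2^{n (d - 1 - d γ)}`, which is geometrically small precisely because
`γ > (d - 1) / d`. The limit `α` lies in `SCH`, and `α(1_K) = Δ_f K` for a rectangle `K` with dyadic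
vertices because `T_m(1_K) = Δ_f K` for all large `m`; continuity of the charge extends this to all
rectangles. On the probabilistic side, `∑_Q E |Δ_X Q|^q / |Q|^{γ q}` converges for `γ < δ / q`, so
almost surely `|Δ_X Q| / |Q|^γ` is bounded over all dyadic cubes.
-/

noncomputable section

namespace StrongCharge

section Translation

section Smoothing

open scoped ContDiff

variable {E : Type*} [NormedAddCommGroup E] [NormedSpace ℝ E] [FiniteDimensional ℝ E]
  [MeasurableSpace E] [BorelSpace E] {μ : Measure E} [μ.IsAddHaarMeasure]

lemma exists_contDiff_hasCompactSupport_tendsto_ae {k : E → ℝ} (hk : AEStronglyMeasurable k μ)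
    {M : ℝ} (hM : ∀ x, |k x| ≤ M) :
    ∃ g : ℕ → E → ℝ, (∀ n, ContDiff ℝ ∞ (g n)) ∧ (∀ n, HasCompactSupport (g n)) ∧
      (∀ n x, |g n x| ≤ M) ∧ ∀ᵐ x ∂μ, Tendsto (fun n => g n x) atTop (𝓝 (k x)) := by
  have hM0 : 0 ≤ M := (abs_nonneg _).trans (hM 0)
  have hki : LocallyIntegrable k μ :=
    (locallyIntegrable_const M).mono hk (Eventually.of_forall fun x => (hM x).trans (le_abs_self M))
  let mollifier : ℕ → ContDiffBump (0 : E) := fun n =>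
    ⟨1 / (n + 1), 2 * (1 / (n + 1)), by positivity, lt_two_mul_self (by positivity)⟩
  let cutoff : ℕ → ContDiffBump (0 : E) := fun n => ⟨n + 1, n + 2, by positivity, by linarith⟩
  let K : ℕ → E → ℝ := fun n =>
    convolution ((mollifier n).normed μ) k (ContinuousLinearMap.lsmul ℝ ℝ) μ
  have hK : ∀ n x, |K n x| ≤ M := fun n x => by
    simpa using dist_convolution_le (z₀ := (0 : ℝ)) hM0 (mollifier n).support_normed_eq.subset
      (mollifier n).nonneg_normed (mollifier n).integral_normed hk
      (fun y _ => by simpa using hM y)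
  have hr : Tendsto (fun n => (mollifier n).rOut) atTop (𝓝 0) := by
    simpa only [mul_zero] using (tendsto_one_div_add_atTop_nhds_zero_nat (𝕜 := ℝ)).const_mul 2
  refine ⟨fun n x => cutoff n x * K n x, fun n => ?_, fun n => ?_, fun n x => ?_, ?_⟩
  · exact (cutoff n).contDiff.mul ((mollifier n).hasCompactSupport_normed.contDiff_convolution_left
      _ (mollifier n).contDiff_normed hki)
  · exact (cutoff n).hasCompactSupport.mul_right
  · rw [abs_mul, abs_of_nonneg (cutoff n).nonneg]
    exact (mul_le_of_le_one_left (abs_nonneg _) (cutoff n).le_one).trans (hK n x)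
  · filter_upwards [ContDiffBump.ae_convolution_tendsto_right_of_locallyIntegrable (K := 2) hr
      (Eventually.of_forall fun n => le_rfl) hki] with x hx
    refine hx.congr' ?_
    filter_upwards [(tendsto_natCast_atTop_atTop (R := ℝ)).eventually_ge_atTop ‖x‖] with n hn
    rw [(cutoff n).one_of_mem_closedBall (mem_closedBall_zero_iff.2 (hn.trans (by simp [cutoff]))),
      one_mul]

end Smoothing

section SegmentAverage

variable {E : Type*} [NormedAddCommGroup E] [NormedSpace ℝ E] {k : E → ℝ}

/-- The average of `k` over the segment from `x - v` to `x`. It is a primitive of the difference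
`k x - k (x - v)` in the direction `v`, see `fderiv_segmentAverage_apply`. -/
def segmentAverage (k : E → ℝ) (v x : E) : ℝ := ∫ s in (0 : ℝ)..1, k (x - s • v)

lemma abs_segmentAverage_le {M : ℝ} (hM : ∀ x, |k x| ≤ M) (v x : E) :
    |segmentAverage k v x| ≤ M := by
  simpa [segmentAverage] using intervalIntegral.norm_integral_le_of_norm_le_const
    (a := 0) (b := 1) (f := fun s : ℝ => k (x - s • v)) (fun s _ => hM _)

lemma hasCompactSupport_segmentAverage (hs : HasCompactSupport k) (v : E) :
    HasCompactSupport (segmentAverage k v) := by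
  have hcompact : IsCompact
      ((fun p : ℝ × E => p.2 + p.1 • v) '' (Set.Icc (0 : ℝ) 1 ×ˢ tsupport k)) :=
    (isCompact_Icc.prod hs.isCompact).image (by fun_prop)
  refine HasCompactSupport.intro hcompact fun x hx => ?_
  refine intervalIntegral.integral_zero_ae (Eventually.of_forall fun s hs => ?_)
  by_contra hne
  rw [Set.uIoc_of_le zero_le_one] at hs
  exact hx ⟨(s, x - s • v), ⟨Set.Ioc_subset_Icc_self hs, subset_tsupport k hne⟩, by simp⟩

lemma contDiff_segmentAverage [MeasurableSpace E] [BorelSpace E] {n : ℕ∞} (hk : ContDiff ℝ n k)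
    (hs : HasCompactSupport k) (v : E) : ContDiff ℝ n (segmentAverage k v) := by
  have hmeas : Measurable fun s : ℝ => s • v := by fun_prop
  let ν : Measure E := (volume.restrict (Set.Ioc (0 : ℝ) 1)).map fun s => s • v
  have hconv : segmentAverage k v =
      convolution (fun _ => (1 : ℝ)) k (ContinuousLinearMap.lsmul ℝ ℝ) ν := by
    ext x
    have hc : Continuous k := hk.continuous
    rw [segmentAverage, convolution_def, intervalIntegral.integral_of_le zero_le_one,
      integral_map hmeas.aemeasurable (Continuous.aestronglyMeasurable (by fun_prop))]
    simp
  have : IsFiniteMeasure ν := Measure.isFiniteMeasure_map _ _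
  exact hconv ▸ hs.contDiff_convolution_right _ (locallyIntegrable_const _) hk

lemma segmentAverage_add_smul (k : E → ℝ) (v x : E) (t : ℝ) :
    segmentAverage k v (x + t • v) = ∫ r in (t - 1)..t, k (x + r • v) := by
  rw [segmentAverage, ← sub_zero t, sub_sub, zero_add,
    ← intervalIntegral.integral_comp_sub_left (fun r => k (x + r • v)) t, sub_zero]
  refine intervalIntegral.integral_congr fun s _ => ?_
  congr 1
  module

lemma fderiv_segmentAverage_apply (hk : Continuous k) {v : E}
    (hd : Differentiable ℝ (segmentAverage k v)) (x : E) :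
    fderiv ℝ (segmentAverage k v) x v = k x - k (x - v) := by
  have hline : HasDerivAt (fun t : ℝ => segmentAverage k v (x + t • v))
      (fderiv ℝ (segmentAverage k v) x v) 0 := by
    simpa [lineDeriv] using
      ((hd x).lineDifferentiableAt (v := v)).hasDerivAt.congr_deriv (hd x).lineDeriv_eq_fderiv
  have hg : Continuous fun r : ℝ => k (x + r • v) := by fun_prop
  have hprimitive : ∀ t, HasDerivAt (fun t : ℝ => ∫ r in (0 : ℝ)..t, k (x + r • v))
      (k (x + t • v)) t := fun t => hg.integral_hasStrictDerivAt 0 t |>.hasDerivAt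
  have hsplit : (fun t : ℝ => segmentAverage k v (x + t • v)) = fun t =>
      (∫ r in (0 : ℝ)..t, k (x + r • v)) - ∫ r in (0 : ℝ)..(t - 1), k (x + r • v) := by
    ext t
    rw [segmentAverage_add_smul, intervalIntegral.integral_interval_sub_left
      (hg.intervalIntegrable _ _) (hg.intervalIntegrable _ _)]
  have hline' := (hprimitive 0).sub ((hprimitive (0 - 1)).comp_sub_const 0 1)
  rw [hsplit] at hline
  exact (hline.unique hline').trans (by simp [sub_eq_add_neg])

end SegmentAverage

variable {d : ℕ} {u : Space d → ℝ}

lemma divergence_smul_const {ψ : Space d → ℝ} {x : Space d} (hψ : DifferentiableAt ℝ ψ x)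
    (v : Space d) : divergence (fun y => ψ y • v) x = fderiv ℝ ψ x v := by
  conv_rhs => rw [← (EuclideanSpace.basisFun (Fin d) ℝ).sum_repr v]
  simp [divergence, (hψ.hasFDerivAt.smul_const v).fderiv, mul_comm]

lemma abs_integral_mul_divergence_le (hV : variation u ≠ ∞) {φ : Space d → Space d}
    (hφ : ContDiff ℝ 1 φ) (hs : HasCompactSupport φ) {c : ℝ} (hc : ∀ x, ‖φ x‖ ≤ c) :
    |∫ x, u x * divergence φ x| ≤ c * (variation u).toReal := by
  rcases ((norm_nonneg _).trans (hc 0)).eq_or_lt with rfl | hpos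
  · have hφ0 : φ = fun _ => 0 := funext fun x => norm_le_zero_iff.1 (hc x)
    simp [hφ0, divergence]
  have htest : IsTestField fun x => c⁻¹ • φ x := by
    refine ⟨hφ.const_smul _, hs.smul_left (f := fun _ => c⁻¹), fun x => ?_⟩
    rw [norm_smul, Real.norm_of_nonneg (inv_nonneg.2 hpos.le), inv_mul_le_one₀ hpos]
    exact hc x
  have hdiv : ∀ x, divergence (fun y => c⁻¹ • φ y) x = c⁻¹ * divergence φ x := fun x => by
    simp [divergence, fderiv_fun_const_smul (hφ.differentiable one_ne_zero x), Finset.mul_sum]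
  have h := (ENNReal.ofReal_le_iff_le_toReal hV).1 (htest.abs_integral_le u)
  simpa only [hdiv, mul_left_comm _ c⁻¹, integral_const_mul, abs_mul,
    abs_of_pos (inv_pos.2 hpos), inv_mul_le_iff₀ hpos] using h

lemma abs_integral_mul_sub_translate_le_of_contDiff (hV : variation u ≠ ∞) {k : Space d → ℝ}
    (hk : ContDiff ℝ 1 k) (hs : HasCompactSupport k) {M : ℝ} (hM : ∀ x, |k x| ≤ M)
    (v : Space d) : |∫ x, u x * (k x - k (x - v))| ≤ M * ‖v‖ * (variation u).toReal := by
  have hsmooth : ContDiff ℝ 1 (segmentAverage k v) := contDiff_segmentAverage hk hs v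
  have hd := hsmooth.differentiable one_ne_zero
  have hdiv : ∀ x, divergence (fun y => segmentAverage k v y • v) x = k x - k (x - v) := fun x => by
    rw [divergence_smul_const (hd x), fderiv_segmentAverage_apply hk.continuous hd]
  simp only [← hdiv]
  refine abs_integral_mul_divergence_le hV (hsmooth.smul contDiff_const)
    (hasCompactSupport_segmentAverage hs v).smul_right fun x => ?_
  rw [Pi.smul_apply', norm_smul]
  exact mul_le_mul_of_nonneg_right (abs_segmentAverage_le hM v x) (norm_nonneg v)

lemma abs_integral_mul_sub_translate_le (hu : Integrable u) (hV : variation u ≠ ∞)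
    {k : Space d → ℝ} (hk : AEStronglyMeasurable k) {M : ℝ} (hM : ∀ x, |k x| ≤ M)
    (v : Space d) : |∫ x, u x * (k x - k (x - v))| ≤ M * ‖v‖ * (variation u).toReal := by
  obtain ⟨g, hg, hgs, hgM, hlim⟩ := exists_contDiff_hasCompactSupport_tendsto_ae hk hM
  have hlim_translate : ∀ᵐ x, Tendsto (fun n => g n (x - v)) atTop (𝓝 (k (x - v))) :=
    (measurePreserving_sub_right volume v).quasiMeasurePreserving.ae hlim
  have hconv : Tendsto (fun n => ∫ x, u x * (g n x - g n (x - v))) atTop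
      (𝓝 (∫ x, u x * (k x - k (x - v)))) := by
    refine tendsto_integral_of_dominated_convergence (fun x => ‖u x‖ * (M + M)) (fun n => ?_)
      (hu.norm.mul_const _) (fun n => Eventually.of_forall fun x => ?_) ?_
    · have := (hg n).continuous
      exact hu.aestronglyMeasurable.mul (Continuous.aestronglyMeasurable (by fun_prop))
    · rw [norm_mul]
      gcongr
      exact (norm_sub_le _ _).trans (add_le_add (hgM n _) (hgM n _))
    · filter_upwards [hlim, hlim_translate] with x hx hx'
      exact (hx.sub hx').const_mul _
  exact le_of_tendsto hconv.abs (Eventually.of_forall fun n =>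
    abs_integral_mul_sub_translate_le_of_contDiff hV ((hg n).of_le (mod_cast le_top)) (hgs n)
      (hgM n) v)

end Translation

section BoxIncrement

variable {ι κ R : Type*} [Fintype ι] [DecidableEq ι] [CommRing R]

/-- The alternating sum of `f` over the vertices of the box with opposite corners `a` and `b`,
with one factor `-1` for each coordinate taken from `a`. -/
def boxIncrement (f : (ι → κ) → R) (a b : ι → κ) : R :=
  ∑ s : Finset ι, (-1) ^ s.card * f (fun i => if i ∈ s then a i else b i)

lemma boxIncrement_eq_sum_prod_mul [DecidableEq κ] (f : (ι → κ) → R) {a b : ι → κ}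
    {S : ι → Finset κ} (ha : ∀ i, a i ∈ S i) (hb : ∀ i, b i ∈ S i) :
    boxIncrement f a b = ∑ k ∈ Fintype.piFinset S,
      (∏ i, ((if k i = b i then 1 else 0) - (if k i = a i then 1 else 0))) * f k := by
  simp only [Finset.prod_sub, Finset.powerset_univ, Finset.sum_mul]
  rw [Finset.sum_comm]
  refine Finset.sum_congr rfl fun s _ => ?_
  rw [Finset.sum_eq_single (fun i => if i ∈ s then a i else b i)]
  · rw [Finset.prod_eq_one, Finset.prod_eq_one] <;> simp +contextual
  · intro k _ hk
    obtain ⟨i, hi⟩ := Function.ne_iff.1 hk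
    by_cases his : i ∈ s
    · rw [Finset.prod_eq_zero (s := s) his (by simp_all)]
      simp
    · rw [Finset.prod_eq_zero (s := Finset.univ \ s) (i := i) (by simpa using his)
        (by simp_all)]
      simp
  · intro h
    refine absurd (Fintype.mem_piFinset.2 fun i => ?_) h
    split_ifs
    exacts [ha i, hb i]

lemma boxIncrement_eq_zero (f : (ι → κ) → R) {a b : ι → κ} {i : ι} (h : a i = b i) :
    boxIncrement f a b = 0 := by
  classical
  rw [boxIncrement_eq_sum_prod_mul f (S := fun i => {a i, b i}) (by simp) (by simp)]
  refine Finset.sum_eq_zero fun k _ => ?_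
  rw [Finset.prod_eq_zero (Finset.mem_univ i) (by simp [h]), zero_mul]

-- The coefficient of `f k` in `boxIncrement f a b` is a product over the coordinates, so it is
-- enough to telescope in each coordinate separately.
lemma sum_boxIncrement_eq {τ : ι → Type*} (f : (ι → κ) → R) (s : ∀ i, Finset (τ i))
    (a b : ∀ i, τ i → κ) {A B : ι → κ}
    (h : ∀ i (g : κ → R), ∑ t ∈ s i, (g (b i t) - g (a i t)) = g (B i) - g (A i)) :
    ∑ r ∈ Fintype.piFinset s, boxIncrement f (fun i => a i (r i)) (fun i => b i (r i)) =
      boxIncrement f A B := by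
  classical
  let S : ι → Finset κ := fun i => {A i, B i} ∪ ((s i).image (a i) ∪ (s i).image (b i))
  rw [boxIncrement_eq_sum_prod_mul f (S := S) (by simp [S]) (by simp [S])]
  have hterm : ∀ r ∈ Fintype.piFinset s,
      boxIncrement f (fun i => a i (r i)) (fun i => b i (r i)) = ∑ k ∈ Fintype.piFinset S,
        (∏ i, ((if k i = b i (r i) then 1 else 0) - (if k i = a i (r i) then 1 else 0))) * f k :=
    fun r hr => by
      have hr : ∀ i, r i ∈ s i := Fintype.mem_piFinset.1 hr
      refine boxIncrement_eq_sum_prod_mul f (fun i => ?_) fun i => ?_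
      · simp [S, Finset.mem_image_of_mem (a i) (hr i)]
      · simp [S, Finset.mem_image_of_mem (b i) (hr i)]
  rw [Finset.sum_congr rfl hterm, Finset.sum_comm]
  refine Finset.sum_congr rfl fun k _ => ?_
  rw [← Finset.sum_mul, ← Finset.prod_univ_sum s fun i t =>
    ((if k i = b i t then (1 : R) else 0) - (if k i = a i t then 1 else 0))]
  congr 1
  exact Finset.prod_congr rfl fun i _ => h i fun y => if k i = y then 1 else 0

lemma sum_intIco_sub {G : Type*} [AddCommGroup G] (g : ℤ → G) {a b : ℤ} (hab : a ≤ b) :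
    ∑ j ∈ Finset.Ico a b, (g (j + 1) - g j) = g b - g a := by
  induction b, hab using Int.leInduction with
  | base => simp
  | succ b hab ih =>
    rw [← Finset.insert_Ico_right_eq_Ico_add_one hab, Finset.sum_insert (by simp), ih]
    abel

end BoxIncrement

section DyadicCells

variable {d : ℕ}

/-- The point of the unit interval closest to `j / 2 ^ n`. -/
def dyadicPoint (n : ℕ) (j : ℤ) : unitInterval :=
  Set.projIcc 0 1 zero_le_one ((j : ℝ) / 2 ^ n)

lemma dyadicPoint_of_eq {n : ℕ} {j : ℤ} {t : unitInterval} (h : (t : ℝ) = j / 2 ^ n) :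
    dyadicPoint n j = t := by
  rw [dyadicPoint, ← h, Set.projIcc_val]

lemma dyadicPoint_succ_two_mul (n : ℕ) (j : ℤ) :
    dyadicPoint (n + 1) (2 * j) = dyadicPoint n j := by
  rw [dyadicPoint, dyadicPoint, pow_succ']
  push_cast
  rw [mul_div_mul_left _ _ two_ne_zero]

lemma dyadicPoint_of_nonpos {n : ℕ} {j : ℤ} (hj : j ≤ 0) : dyadicPoint n j = 0 :=
  Set.projIcc_of_le_left _ (div_nonpos_of_nonpos_of_nonneg (mod_cast hj) (by positivity))

lemma dyadicPoint_of_two_pow_le {n : ℕ} {j : ℤ} (hj : 2 ^ n ≤ j) : dyadicPoint n j = 1 :=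
  Set.projIcc_of_right_le _ ((one_le_div (by positivity)).2 (mod_cast hj))

/-- The increment of `f` over the dyadic cell of generation `n` with index `j`. It vanishes when the
cell does not lie in the unit cube, since then two opposite faces are projected to the same one. -/
def cellIncrement (f : (Fin d → unitInterval) → ℝ) (n : ℕ) (j : Fin d → ℤ) : ℝ :=
  boxIncrement f (fun i => dyadicPoint n (j i)) (fun i => dyadicPoint n (j i + 1))

lemma cellIncrement_eq_zero (f : (Fin d → unitInterval) → ℝ) {n : ℕ} {j : Fin d → ℤ} {i : Fin d}
    (h : ¬ (0 ≤ j i ∧ j i < 2 ^ n)) : cellIncrement f n j = 0 := by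
  refine boxIncrement_eq_zero f (i := i) ?_
  rcases not_and_or.1 h with h | h
  · rw [dyadicPoint_of_nonpos (by lia), dyadicPoint_of_nonpos (by lia)]
  · rw [dyadicPoint_of_two_pow_le (by lia), dyadicPoint_of_two_pow_le (by lia)]

lemma cellIncrement_natCast (f : (Fin d → unitInterval) → ℝ) (n : ℕ) (k : Fin d → Fin (2 ^ n)) :
    cellIncrement f n (fun i => ((k i : ℕ) : ℤ)) = increment f (dyadicCube n k) := by
  have hlo : (fun i => dyadicPoint n ((k i : ℕ) : ℤ)) = (dyadicCube n k).lo :=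
    funext fun i => dyadicPoint_of_eq (by simp [dyadicCube])
  have hhi : (fun i => dyadicPoint n (((k i : ℕ) : ℤ) + 1)) = (dyadicCube n k).hi :=
    funext fun i => dyadicPoint_of_eq (by simp [dyadicCube])
  rw [cellIncrement, hlo, hhi]
  rfl

lemma abs_cellIncrement_le {f : (Fin d → unitInterval) → ℝ} {n : ℕ} {c : ℝ}
    (h : ∀ k : Fin d → Fin (2 ^ n), |increment f (dyadicCube n k)| ≤ c) (j : Fin d → ℤ) :
    |cellIncrement f n j| ≤ c := by
  by_cases hj : ∀ i, 0 ≤ j i ∧ j i < 2 ^ n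
  · choose k hk using fun i => Int.eq_ofNat_of_zero_le (hj i).1
    have hlt : ∀ i, k i < 2 ^ n := fun i => by
      have := (hj i).2
      rw [hk i] at this
      exact_mod_cast this
    obtain rfl : j = fun i => (k i : ℤ) := funext hk
    exact cellIncrement_natCast f n (fun i => ⟨k i, hlt i⟩) ▸ h _
  · obtain ⟨i, hi⟩ := not_forall.1 hj
    rw [cellIncrement_eq_zero f hi, abs_zero]
    exact (abs_nonneg _).trans (h fun _ => 0)

lemma cellIncrement_eq_sum_succ (f : (Fin d → unitInterval) → ℝ) (n : ℕ) (k : Fin d → ℤ) :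
    cellIncrement f n k =
      ∑ r : Fin d → Fin 2, cellIncrement f (n + 1) fun i => 2 * k i + (r i : ℕ) := by
  rw [← Fintype.piFinset_univ, cellIncrement]
  refine (sum_boxIncrement_eq f _
    (fun i (t : Fin 2) => dyadicPoint (n + 1) (2 * k i + (t : ℕ)))
    (fun i (t : Fin 2) => dyadicPoint (n + 1) (2 * k i + (t : ℕ) + 1)) fun i g => ?_).symm
  have htop : 2 * k i + 1 + 1 = 2 * (k i + 1) := by ring
  simp [Fin.sum_univ_two, htop, dyadicPoint_succ_two_mul]
  ring

lemma sum_cellIncrement_eq_boxIncrement (f : (Fin d → unitInterval) → ℝ) (n : ℕ)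
    {A B : Fin d → ℤ} (hAB : A ≤ B) :
    ∑ j ∈ Fintype.piFinset fun i => Finset.Ico (A i) (B i), cellIncrement f n j =
      boxIncrement f (fun i => dyadicPoint n (A i)) (fun i => dyadicPoint n (B i)) :=
  sum_boxIncrement_eq f (fun i => Finset.Ico (A i) (B i)) (fun _ => dyadicPoint n)
    (fun _ j => dyadicPoint n (j + 1)) fun i g => sum_intIco_sub (g ∘ dyadicPoint n) (hAB i)

end DyadicCells

section BlockAverage

variable {d : ℕ}

/-- The average of `G : ℤ^d → ℝ` over the block of side `2` that contains `j`. -/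
def blockAverage (G : (Fin d → ℤ) → ℝ) (j : Fin d → ℤ) : ℝ :=
  (2 ^ d)⁻¹ * ∑ r : Fin d → Fin 2, G fun i => 2 * (j i / 2) + (r i : ℕ)

/-- The restriction of `G` to the indices whose vector of parities is `r`, extended by `0`. -/
def parityPart (G : (Fin d → ℤ) → ℝ) (r : Fin d → Fin 2) (j : Fin d → ℤ) : ℝ :=
  if ∀ i, j i % 2 = (r i : ℕ) then G j else 0

lemma abs_parityPart_le {G : (Fin d → ℤ) → ℝ} {M : ℝ} (hM : ∀ j, |G j| ≤ M) (r : Fin d → Fin 2)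
    (j : Fin d → ℤ) : |parityPart G r j| ≤ M := by
  rw [parityPart]
  split_ifs
  · exact hM j
  · rw [abs_zero]
    exact (abs_nonneg _).trans (hM j)

lemma exists_parity (j : Fin d → ℤ) : ∃ r : Fin d → Fin 2, ∀ i, j i % 2 = (r i : ℕ) :=
  ⟨fun i => ⟨(j i % 2).toNat, by lia⟩, fun i => by dsimp only; lia⟩

lemma sum_parityPart (G : (Fin d → ℤ) → ℝ) (j : Fin d → ℤ) : ∑ r, parityPart G r j = G j := by
  obtain ⟨r₀, hr₀⟩ := exists_parity j
  rw [Finset.sum_eq_single r₀ (fun r _ hr => ?_) (by simp), parityPart, if_pos hr₀]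
  refine if_neg fun h => hr (funext fun i => Fin.ext ?_)
  have := h i
  have := hr₀ i
  lia

lemma sum_parityPart_translate (G : (Fin d → ℤ) → ℝ) (j : Fin d → ℤ) (r' : Fin d → Fin 2) :
    ∑ r : Fin d → Fin 2, parityPart G r' (fun i => j i - ((r i : ℕ) - (r' i : ℕ))) =
      G fun i => 2 * (j i / 2) + (r' i : ℕ) := by
  obtain ⟨r₀, hr₀⟩ := exists_parity j
  rw [Finset.sum_eq_single r₀ (fun r _ hr => ?_) (by simp), parityPart,
    if_pos fun i => by have := hr₀ i; have := (r' i).isLt; lia]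
  · congr 1
    ext i
    have := hr₀ i
    lia
  · refine if_neg fun h => hr (funext fun i => Fin.ext ?_)
    have hr' : (j i - ((r i : ℕ) - (r' i : ℕ))) % 2 = ((r' i : ℕ) : ℤ) := h i
    have := hr₀ i
    omega

lemma sub_blockAverage_eq_sum_translate (G : (Fin d → ℤ) → ℝ) (j : Fin d → ℤ) :
    G j - blockAverage G j = (2 ^ d)⁻¹ * ∑ r : Fin d → Fin 2, ∑ r' : Fin d → Fin 2,
      (parityPart G r' j - parityPart G r' fun i => j i - ((r i : ℕ) - (r' i : ℕ))) := by
  simp only [Finset.sum_sub_distrib, sum_parityPart]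
  rw [Finset.sum_comm (f := fun r r' : Fin d → Fin 2 => parityPart G r' fun i =>
    j i - ((r i : ℕ) - (r' i : ℕ)))]
  simp only [sum_parityPart_translate, Finset.sum_const, Finset.card_univ, Fintype.card_pi,
    Fintype.card_fin, Finset.prod_const, nsmul_eq_mul, blockAverage]
  push_cast
  field_simp

/-- The index of the half-open dyadic cell of generation `n` that contains `x`. -/
def cellIndex (n : ℕ) (x : Space d) : Fin d → ℤ := fun i => ⌊2 ^ n * x i⌋

lemma measurable_cellIndex (n : ℕ) : Measurable (cellIndex (d := d) n) := by
  refine measurable_pi_lambda _ fun i => Int.measurable_floor.comp ?_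
  exact (EuclideanSpace.proj i : Space d →L[ℝ] ℝ).measurable.const_mul _

lemma measurable_comp_cellIndex (G : (Fin d → ℤ) → ℝ) (n : ℕ) :
    Measurable fun x : Space d => G (cellIndex n x) :=
  (Measurable.of_discrete (f := G)).comp (measurable_cellIndex n)

lemma cellIndex_eq_div_two (n : ℕ) (x : Space d) :
    cellIndex n x = fun i => cellIndex (n + 1) x i / 2 := by
  ext i
  have hhalf : (2 : ℝ) ^ n * x i = 2 ^ (n + 1) * x i / (2 : ℕ) := by
    rw [pow_succ]
    push_cast
    ring
  rw [cellIndex, cellIndex, hhalf, Int.floor_div_natCast]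
  rfl

/-- The vector that translates cells of generation `n` by `m` on the level of indices. -/
def gridVector (n : ℕ) (m : Fin d → ℤ) : Space d := WithLp.toLp 2 fun i => (m i : ℝ) / 2 ^ n

lemma cellIndex_sub_gridVector (n : ℕ) (x : Space d) (m : Fin d → ℤ) :
    cellIndex n (x - gridVector n m) = fun i => cellIndex n x i - m i := by
  ext i
  simp only [cellIndex, gridVector, PiLp.sub_apply, mul_sub]
  rw [mul_div_cancel₀ _ (by positivity), Int.floor_sub_intCast]

lemma norm_gridVector_le (n : ℕ) {m : Fin d → ℤ} (hm : ∀ i, |m i| ≤ 1) :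
    ‖gridVector n m‖ ≤ √d / 2 ^ n := by
  rw [EuclideanSpace.norm_eq, Real.sqrt_le_left (by positivity), div_pow,
    Real.sq_sqrt (by positivity)]
  calc ∑ i, ‖gridVector n m i‖ ^ 2 ≤ ∑ _i : Fin d, 1 / (2 ^ n) ^ 2 := by
        refine Finset.sum_le_sum fun i _ => ?_
        simp only [gridVector, Real.norm_eq_abs, sq_abs, div_pow]
        gcongr
        rw [sq_le_one_iff_abs_le_one]
        exact_mod_cast hm i
    _ = d / (2 ^ n) ^ 2 := by simp [div_eq_mul_inv]

lemma abs_integral_mul_sub_blockAverage_le {u : Space d → ℝ} (hu : Integrable u)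
    (hV : variation u ≠ ∞) {G : (Fin d → ℤ) → ℝ} {M : ℝ} (hM : ∀ j, |G j| ≤ M) (n : ℕ) :
    |∫ x, u x * (G (cellIndex n x) - blockAverage G (cellIndex n x))| ≤
      2 ^ d * (M * (√d / 2 ^ n) * (variation u).toReal) := by
  let p : (Fin d → Fin 2) → Space d → ℝ := fun r x => parityPart G r (cellIndex n x)
  let v : (Fin d → Fin 2) → (Fin d → Fin 2) → Space d := fun r r' =>
    gridVector n fun i => (r i : ℕ) - (r' i : ℕ)
  have hM0 : 0 ≤ M := (abs_nonneg _).trans (hM 0)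
  have hp : ∀ r, Measurable (p r) := fun r => measurable_comp_cellIndex _ n
  have hpM : ∀ r x, |p r x| ≤ M := fun r x => abs_parityPart_le hM r _
  have hi : ∀ r r', Integrable fun x => u x * (p r' x - p r' (x - v r r')) := fun r r' => by
    refine hu.mul_bdd (c := M + M) ?_ (Eventually.of_forall fun x => ?_)
    · exact ((hp r').sub ((hp r').comp (measurable_sub_const _))).aestronglyMeasurable
    · exact (norm_sub_le _ _).trans (add_le_add (hpM r' _) (hpM r' _))
  have hbound : ∀ r r', |∫ x, u x * (p r' x - p r' (x - v r r'))| ≤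
      M * (√d / 2 ^ n) * (variation u).toReal := fun r r' => by
    refine (abs_integral_mul_sub_translate_le hu hV (hp r').aestronglyMeasurable (hpM r')
      (v r r')).trans ?_
    gcongr
    refine norm_gridVector_le n fun i => ?_
    have := (r i).isLt
    have := (r' i).isLt
    rw [abs_le]
    lia
  have hpt : ∀ x, u x * (G (cellIndex n x) - blockAverage G (cellIndex n x)) =
      (2 ^ d)⁻¹ * ∑ r, ∑ r', u x * (p r' x - p r' (x - v r r')) := fun x => by
    simp only [sub_blockAverage_eq_sum_translate, p, v, cellIndex_sub_gridVector, ← Finset.mul_sum]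
    ring
  simp only [hpt, integral_const_mul]
  rw [integral_finsetSum _ fun r _ => integrable_finsetSum _ fun r' _ => hi r r', abs_mul,
    abs_of_pos (by positivity), inv_mul_le_iff₀ (by positivity)]
  simp only [integral_finsetSum _ fun r' _ => hi _ r']
  refine (Finset.abs_sum_le_sum_abs _ _).trans ((Finset.sum_le_card_nsmul _ _ _ fun r _ =>
    (Finset.abs_sum_le_sum_abs _ _).trans (Finset.sum_le_card_nsmul _ _ _ fun r' _ =>
      hbound r r')).trans (le_of_eq ?_))
  simp [mul_assoc]

end BlockAverage

section DyadicDensity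

variable {d : ℕ}

/-- The mean density of `Δ_f` on the dyadic cell of generation `n` with index `j`: the cell has
volume `2 ^ (-d * n)`. -/
def dyadicDensity (f : (Fin d → unitInterval) → ℝ) (n : ℕ) (j : Fin d → ℤ) : ℝ :=
  (2 ^ d) ^ n * cellIncrement f n j

lemma blockAverage_dyadicDensity_succ (f : (Fin d → unitInterval) → ℝ) (n : ℕ)
    (j : Fin d → ℤ) :
    blockAverage (dyadicDensity f (n + 1)) j = dyadicDensity f n fun i => j i / 2 := by
  simp only [blockAverage, dyadicDensity, ← Finset.mul_sum, cellIncrement_eq_sum_succ f n, pow_succ]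
  field_simp

lemma abs_dyadicDensity_le {f : (Fin d → unitInterval) → ℝ} {n : ℕ} {c : ℝ}
    (h : ∀ k : Fin d → Fin (2 ^ n), |increment f (dyadicCube n k)| ≤ c) (j : Fin d → ℤ) :
    |dyadicDensity f n j| ≤ (2 ^ d) ^ n * c := by
  rw [dyadicDensity, abs_mul, abs_of_pos (by positivity)]
  gcongr
  exact abs_cellIncrement_le h j

lemma exists_abs_dyadicDensity_le (f : (Fin d → unitInterval) → ℝ) (n : ℕ) :
    ∃ M, ∀ j, |dyadicDensity f n j| ≤ M :=
  ⟨_, abs_dyadicDensity_le fun k => Finset.single_le_sum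
    (f := fun k => |increment f (dyadicCube n k)|) (fun _ _ => abs_nonneg _) (Finset.mem_univ k)⟩

lemma abs_integral_mul_dyadicDensity_succ_sub_le {u : Space d → ℝ} (hu : Integrable u)
    (hV : variation u ≠ ∞) {f : (Fin d → unitInterval) → ℝ} {n : ℕ} {c : ℝ}
    (h : ∀ k : Fin d → Fin (2 ^ (n + 1)), |increment f (dyadicCube (n + 1) k)| ≤ c) :
    |∫ x, u x * (dyadicDensity f (n + 1) (cellIndex (n + 1) x) -
        dyadicDensity f n (cellIndex n x))| ≤
      2 ^ d * ((2 ^ d) ^ (n + 1) * c * (√d / 2 ^ (n + 1)) * (variation u).toReal) := by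
  simpa only [blockAverage_dyadicDensity_succ, ← cellIndex_eq_div_two] using
    abs_integral_mul_sub_blockAverage_le hu hV (abs_dyadicDensity_le h) (n + 1)

lemma volume_real_preimage_pi (s : Fin d → Set ℝ) (hs : ∀ i, MeasurableSet (s i)) :
    (volume : Measure (Space d)).real (WithLp.ofLp ⁻¹' Set.univ.pi s) =
      ∏ i, (volume : Measure ℝ).real (s i) := by
  rw [measureReal_def, (PiLp.volume_preserving_ofLp (Fin d)).measure_preimage
    (MeasurableSet.univ_pi hs).nullMeasurableSet, volume_pi_pi, ENNReal.toReal_prod]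
  rfl

lemma Rect.vol_eq_prod (K : Rect d) : K.vol = ∏ i, ((K.hi i : ℝ) - K.lo i) := by
  rw [Rect.vol, Rect.toSet_eq_preimage, ← Set.pi_univ_Icc,
    volume_real_preimage_pi _ fun _ => measurableSet_Icc]
  exact Finset.prod_congr rfl fun i _ => Real.volume_real_Icc_of_le (K.lo_lt_hi i).le

lemma vol_dyadicCube (n : ℕ) (k : Fin d → Fin (2 ^ n)) :
    (dyadicCube n k).vol = ((2 ^ d)⁻¹) ^ n := by
  have h : ∀ i, ((dyadicCube n k).hi i : ℝ) - (dyadicCube n k).lo i = (2 ^ n)⁻¹ := fun i => by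
    simp only [dyadicCube]
    push_cast
    ring
  simp only [Rect.vol_eq_prod, h, Finset.prod_const, Finset.card_univ, Fintype.card_fin, inv_pow,
    ← pow_mul, mul_comm]

lemma volume_real_cell (n : ℕ) (j : Fin d → ℤ) :
    (volume : Measure (Space d)).real (cellIndex n ⁻¹' {j}) = ((2 ^ d) ^ n)⁻¹ := by
  have hp : (0 : ℝ) < 2 ^ n := by positivity
  have hcell : cellIndex n ⁻¹' {j} = (WithLp.ofLp : Space d → (Fin d → ℝ)) ⁻¹'
      Set.univ.pi fun i => Set.Ico ((j i : ℝ) / 2 ^ n) ((j i + 1) / 2 ^ n) := by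
    ext x
    simp [funext_iff, cellIndex, Int.floor_eq_iff, div_le_iff₀' hp, lt_div_iff₀' hp]
  have hside : ∀ i, volume.real (Set.Ico ((j i : ℝ) / 2 ^ n) ((j i + 1) / 2 ^ n)) = (2 ^ n)⁻¹ :=
    fun i => by
      rw [Real.volume_real_Ico_of_le (by gcongr; linarith)]
      ring
  rw [hcell, volume_real_preimage_pi _ fun _ => measurableSet_Ico]
  simp only [hside, Finset.prod_const, Finset.card_univ, Fintype.card_fin, inv_pow, ← pow_mul,
    mul_comm]

lemma setIntegral_comp_cellIndex (G : (Fin d → ℤ) → ℝ) (n : ℕ) (R : Finset (Fin d → ℤ)) :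
    ∫ x : Space d in cellIndex n ⁻¹' R, G (cellIndex n x) =
      ((2 ^ d) ^ n)⁻¹ * ∑ j ∈ R, G j := by
  have hm : ∀ j : Fin d → ℤ, MeasurableSet (cellIndex (d := d) n ⁻¹' {j}) := fun j =>
    measurable_cellIndex n (measurableSet_singleton j)
  have hfin : ∀ j : Fin d → ℤ, volume (cellIndex (d := d) n ⁻¹' {j}) ≠ ∞ := fun j h => by
    have hpos : (0 : ℝ) < ((2 ^ d) ^ n)⁻¹ := by positivity
    rw [← volume_real_cell n j, measureReal_def, h] at hpos
    exact hpos.ne rfl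
  have hconst : ∀ j, Set.EqOn (fun x : Space d => G (cellIndex n x)) (fun _ => G j)
      (cellIndex n ⁻¹' {j}) := fun j x hx => congrArg G hx
  have hdisj : Set.Pairwise (R : Set (Fin d → ℤ))
      (Function.onFun Disjoint fun j => cellIndex (d := d) n ⁻¹' {j}) :=
    (Set.pairwiseDisjoint_fiber (cellIndex n) _).imp fun _ _ h => h
  rw [← Set.biUnion_preimage_singleton, Finset.mul_sum]
  refine (integral_biUnion_finset R (fun j _ => hm j) hdisj fun j _ =>
    (integrableOn_congr_fun (hconst j) (hm j)).2 (integrableOn_const (hfin j))).trans ?_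
  refine Finset.sum_congr rfl fun j _ => ?_
  rw [setIntegral_congr_fun (hm j) (hconst j), setIntegral_const, volume_real_cell, smul_eq_mul]

end DyadicDensity

section Rectangles

variable {d : ℕ}

/-- The vertices of `K` lie on the dyadic grid of generation `n`. -/
def Rect.IsDyadic (n : ℕ) (K : Rect d) : Prop :=
  ∃ A B : Fin d → ℤ, ∀ i, (K.lo i : ℝ) = A i / 2 ^ n ∧ (K.hi i : ℝ) = B i / 2 ^ n

lemma Rect.IsDyadic.succ {n : ℕ} {K : Rect d} (h : K.IsDyadic n) : K.IsDyadic (n + 1) := by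
  obtain ⟨A, B, hAB⟩ := h
  refine ⟨fun i => 2 * A i, fun i => 2 * B i, fun i => ?_⟩
  push_cast
  rw [pow_succ', mul_div_mul_left _ _ two_ne_zero, mul_div_mul_left _ _ two_ne_zero]
  exact hAB i

lemma Rect.IsDyadic.mono {m n : ℕ} {K : Rect d} (h : K.IsDyadic m) (hmn : m ≤ n) :
    K.IsDyadic n :=
  Nat.le_induction h (fun _ _ => Rect.IsDyadic.succ) n hmn

lemma Rect.toSet_ae_eq_preimage_cellIndex {n : ℕ} {K : Rect d} {A B : Fin d → ℤ}
    (h : ∀ i, (K.lo i : ℝ) = A i / 2 ^ n ∧ (K.hi i : ℝ) = B i / 2 ^ n) :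
    K.toSet =ᵐ[volume]
      cellIndex n ⁻¹' (Fintype.piFinset fun i => Finset.Ico (A i) (B i) : Set (Fin d → ℤ)) := by
  have hp : (0 : ℝ) < 2 ^ n := by positivity
  have hIco := (PiLp.volume_preserving_ofLp (Fin d)).quasiMeasurePreserving.preimage_ae_eq
    (Measure.univ_pi_Ico_ae_eq_Icc (μ := fun _ : Fin d => (volume : Measure ℝ))
      (f := fun i => (K.lo i : ℝ)) (g := fun i => (K.hi i : ℝ)))
  rw [K.toSet_eq_preimage]
  refine hIco.symm.trans (Eventually.of_forall fun x => propext ?_)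
  change _ ∈ Set.univ.pi _ ↔ cellIndex n x ∈ (_ : Set _)
  simp [cellIndex, h, Int.le_floor, Int.floor_lt, div_le_iff₀' hp, lt_div_iff₀' hp]

lemma setIntegral_dyadicDensity (f : (Fin d → unitInterval) → ℝ) {n : ℕ} {K : Rect d}
    (hK : K.IsDyadic n) :
    ∫ x in K.toSet, dyadicDensity f n (cellIndex n x) = increment f K := by
  obtain ⟨A, B, h⟩ := hK
  have hAB : A ≤ B := fun i => by
    have hlt : (K.lo i : ℝ) < K.hi i := K.lo_lt_hi i
    rw [(h i).1, (h i).2, div_lt_div_iff_of_pos_right (by positivity)] at hlt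
    exact_mod_cast hlt.le
  have hinc : ∑ j ∈ Fintype.piFinset fun i => Finset.Ico (A i) (B i), cellIncrement f n j =
      increment f K := by
    rw [sum_cellIncrement_eq_boxIncrement f n hAB, funext fun i => dyadicPoint_of_eq (h i).1,
      funext fun i => dyadicPoint_of_eq (h i).2]
    rfl
  rw [setIntegral_congr_set (Rect.toSet_ae_eq_preimage_cellIndex h), setIntegral_comp_cellIndex,
    ← hinc]
  simp only [dyadicDensity, ← Finset.mul_sum]
  rw [inv_mul_cancel_left₀ (by positivity)]

/-- The smallest rectangle with vertices on the dyadic grid of generation `n` that contains `K`. -/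
def Rect.dyadicHull (K : Rect d) (n : ℕ) : Rect d where
  lo i := ⟨(⌊(K.lo i : ℝ) * 2 ^ n⌋₊ : ℝ) / 2 ^ n, dyadic_mem (by
    refine Nat.floor_le_of_le ?_
    push_cast
    exact mul_le_of_le_one_left (by positivity) (K.lo i).2.2)⟩
  hi i := ⟨(⌈(K.hi i : ℝ) * 2 ^ n⌉₊ : ℝ) / 2 ^ n, dyadic_mem (by
    refine Nat.ceil_le.2 ?_
    push_cast
    exact mul_le_of_le_one_left (by positivity) (K.hi i).2.2)⟩
  lo_lt_hi i := by
    have hp : (0 : ℝ) < 2 ^ n := by positivity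
    have hlt : (K.lo i : ℝ) < K.hi i := K.lo_lt_hi i
    rw [Subtype.mk_lt_mk, div_lt_div_iff_of_pos_right hp]
    exact (Nat.floor_le (mul_nonneg (K.lo i).2.1 hp.le)).trans_lt
      ((mul_lt_mul_of_pos_right hlt hp).trans_le (Nat.le_ceil _))

lemma Rect.isDyadic_dyadicHull (K : Rect d) (n : ℕ) : (K.dyadicHull n).IsDyadic n :=
  ⟨fun i => ⌊(K.lo i : ℝ) * 2 ^ n⌋₊, fun i => ⌈(K.hi i : ℝ) * 2 ^ n⌉₊,
    fun i => by simp [Rect.dyadicHull]⟩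

lemma Rect.subset_dyadicHull (K : Rect d) (n : ℕ) : K.toSet ⊆ (K.dyadicHull n).toSet := by
  have hp : (0 : ℝ) < 2 ^ n := by positivity
  refine fun x hx i => ⟨le_trans ?_ (hx i).1, (hx i).2.trans ?_⟩
  · exact (div_le_iff₀ hp).2 (Nat.floor_le (mul_nonneg (K.lo i).2.1 hp.le))
  · exact (le_div_iff₀ hp).2 (Nat.le_ceil _)

lemma tendsto_two_pow_atTop : Tendsto (fun n : ℕ => (2 : ℝ) ^ n) atTop atTop :=
  tendsto_pow_atTop_atTop_of_one_lt one_lt_two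

lemma Rect.tendsto_dyadicHull_lo (K : Rect d) (i : Fin d) :
    Tendsto (fun n => (K.dyadicHull n).lo i) atTop (𝓝 (K.lo i)) :=
  tendsto_subtype_rng.2
    ((tendsto_nat_floor_mul_div_atTop (K.lo i).2.1).comp tendsto_two_pow_atTop)

lemma Rect.tendsto_dyadicHull_hi (K : Rect d) (i : Fin d) :
    Tendsto (fun n => (K.dyadicHull n).hi i) atTop (𝓝 (K.hi i)) :=
  tendsto_subtype_rng.2
    ((tendsto_nat_ceil_mul_div_atTop (K.hi i).2.1).comp tendsto_two_pow_atTop)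

lemma tendsto_increment_dyadicHull {f : (Fin d → unitInterval) → ℝ} (hf : Continuous f)
    (K : Rect d) : Tendsto (fun n => increment f (K.dyadicHull n)) atTop (𝓝 (increment f K)) := by
  refine tendsto_finsetSum _ fun s _ => ((hf.tendsto _).comp ?_).const_mul _
  refine tendsto_pi_nhds.2 fun i => ?_
  split_ifs
  exacts [K.tendsto_dyadicHull_lo i, K.tendsto_dyadicHull_hi i]

lemma Rect.tendsto_vol_dyadicHull (K : Rect d) :
    Tendsto (fun n => (K.dyadicHull n).vol) atTop (𝓝 K.vol) := by
  simp only [Rect.vol_eq_prod]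
  refine tendsto_finsetProd _ fun i _ => Tendsto.sub ?_ ?_
  exacts [tendsto_subtype_rng.1 (K.tendsto_dyadicHull_hi i),
    tendsto_subtype_rng.1 (K.tendsto_dyadicHull_lo i)]

lemma Rect.tendsto_volume_symmDiff_dyadicHull (K : Rect d) :
    Tendsto (fun n => volume ((K.dyadicHull n).toSet ∆ K.toSet)) atTop (𝓝 0) := by
  have hfin : ∀ L : Rect d, volume L.toSet ≠ ∞ := fun L =>
    ((measure_mono L.subset_cube).trans_lt (volume_cube_lt_top d)).ne
  have hvol : ∀ n, volume ((K.dyadicHull n).toSet ∆ K.toSet) =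
      ENNReal.ofReal ((K.dyadicHull n).vol - K.vol) := fun n => by
    rw [symmDiff_of_ge (K.subset_dyadicHull n),
      ← ofReal_measureReal (measure_ne_top_of_subset Set.sdiff_subset (hfin _)),
      measureReal_sdiff (K.subset_dyadicHull n) K.measurableSet (hfin _)]
    rfl
  simp only [hvol]
  simpa using ENNReal.tendsto_ofReal (K.tendsto_vol_dyadicHull.sub_const K.vol)

end Rectangles

section Functionals

variable {d : ℕ}

lemma BV.toReal_variation_le_norm (u : BV d) : (variation u.toL1).toReal ≤ ‖u‖ :=
  le_add_of_nonneg_left (norm_nonneg _)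

/-- The continuous inclusion of `BV([0,1]^d)` into `L¹(ℝ^d)`. -/
def BV.toL1CLM : BV d →L[ℝ] Lp ℝ 1 (volume : Measure (Space d)) :=
  BV.toL1.mkContinuous 1 fun u => by
    rw [one_mul]
    exact le_add_of_nonneg_right ENNReal.toReal_nonneg

/-- The functional `u ↦ ∫ g u` on `BV([0,1]^d)` given by an essentially bounded `g`. -/
def integralFunctional (g : Lp ℝ ∞ (volume : Measure (Space d))) : StrongDual ℝ (BV d) :=
  ((ContinuousLinearMap.mul ℝ ℝ).lpPairing volume ∞ 1 g).comp BV.toL1CLM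

lemma integralFunctional_apply (g : Lp ℝ ∞ (volume : Measure (Space d))) (u : BV d) :
    integralFunctional g u = ∫ x, g x * u.toL1 x :=
  ContinuousLinearMap.lpPairing_eq_integral _ _ _

lemma integralFunctional_mem_rangeT (g : Lp ℝ ∞ (volume : Measure (Space d))) :
    integralFunctional g ∈ rangeT d := by
  have : IsFiniteMeasure (volume.restrict (cube d)) :=
    isFiniteMeasure_restrict.2 (volume_cube_lt_top d).ne
  refine ⟨g, ((Lp.memLp g).restrict _).mono_exponent le_top, fun u => ⟨?_, ?_⟩⟩
  · exact ((L1.integrable_coeFn u.toL1).mul_of_top_right (Lp.memLp g)).integrableOn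
  · rw [integralFunctional_apply, setIntegral_eq_integral_of_ae_compl_eq_zero]
    filter_upwards [u.2.1] with x hx hxc
    exact mul_eq_zero_of_right _ (hx hxc)

lemma memLp_dyadicDensity (f : (Fin d → unitInterval) → ℝ) (n : ℕ) :
    MemLp (fun x : Space d => dyadicDensity f n (cellIndex n x)) ∞ := by
  obtain ⟨M, hM⟩ := exists_abs_dyadicDensity_le f n
  exact memLp_top_of_bound (measurable_comp_cellIndex _ n).aestronglyMeasurable M
    (Eventually.of_forall fun x => hM _)

/-- Integration against the dyadic density of generation `n`. -/
def dyadicFunctional (f : (Fin d → unitInterval) → ℝ) (n : ℕ) : StrongDual ℝ (BV d) :=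
  integralFunctional (memLp_dyadicDensity f n).toLp

lemma dyadicFunctional_apply (f : (Fin d → unitInterval) → ℝ) (n : ℕ) (u : BV d) :
    dyadicFunctional f n u = ∫ x, u.toL1 x * dyadicDensity f n (cellIndex n x) := by
  rw [dyadicFunctional, integralFunctional_apply]
  refine integral_congr_ae ?_
  filter_upwards [(memLp_dyadicDensity f n).coeFn_toLp] with x hx
  rw [hx, mul_comm]

lemma norm_dyadicFunctional_succ_sub_le {f : (Fin d → unitInterval) → ℝ} {n : ℕ} {c : ℝ}
    (h : ∀ k : Fin d → Fin (2 ^ (n + 1)), |increment f (dyadicCube (n + 1) k)| ≤ c) :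
    ‖dyadicFunctional f (n + 1) - dyadicFunctional f n‖ ≤
      2 ^ d * ((2 ^ d) ^ (n + 1) * c * (√d / 2 ^ (n + 1))) := by
  have hc : 0 ≤ c := (abs_nonneg _).trans (h fun _ => 0)
  have hi : ∀ (m : ℕ) (u : BV d), Integrable fun x =>
      u.toL1 x * dyadicDensity f m (cellIndex m x) := fun m u =>
    (L1.integrable_coeFn u.toL1).mul_of_top_left (memLp_dyadicDensity f m)
  refine ContinuousLinearMap.opNorm_le_bound _ (by positivity) fun u => ?_
  have hu := abs_integral_mul_dyadicDensity_succ_sub_le (L1.integrable_coeFn u.toL1)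
    u.variation_ne_top h
  simp only [mul_sub, integral_sub (hi _ u) (hi _ u), ← dyadicFunctional_apply] at hu
  rw [sub_apply, Real.norm_eq_abs]
  refine hu.trans ?_
  rw [← mul_assoc]
  gcongr
  exact u.toReal_variation_le_norm

lemma cauchySeq_dyadicFunctional {f : (Fin d → unitInterval) → ℝ} {c θ : ℝ}
    (hθ : 2 ^ d * θ < 2)
    (h : ∀ n (k : Fin d → Fin (2 ^ n)), |increment f (dyadicCube n k)| ≤ c * θ ^ n) :
    CauchySeq (dyadicFunctional f) := by
  refine cauchySeq_of_le_geometric (2 ^ d * θ / 2) (2 ^ d * c * √d * (2 ^ d * θ / 2))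
    ((div_lt_one two_pos).2 hθ) fun n => ?_
  rw [dist_comm, dist_eq_norm]
  refine (norm_dyadicFunctional_succ_sub_le (h (n + 1))).trans_eq ?_
  rw [div_pow, mul_pow]
  field_simp
  ring

end Functionals

lemma tendsto_apply_zero_of_mem_closure {𝕜 E F ι : Type*} [NontriviallyNormedField 𝕜]
    [SeminormedAddCommGroup E] [NormedSpace 𝕜 E] [SeminormedAddCommGroup F] [NormedSpace 𝕜 F]
    {l : Filter ι} {w : ι → E} {R : ℝ} (hw : ∀ i, ‖w i‖ ≤ R) {S : Set (E →L[𝕜] F)}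
    (hS : ∀ L ∈ S, Tendsto (fun i => L (w i)) l (𝓝 0)) {α : E →L[𝕜] F} (hα : α ∈ closure S) :
    Tendsto (fun i => α (w i)) l (𝓝 0) := by
  rw [Metric.tendsto_nhds]
  intro ε hε
  have hR : 0 < |R| + 1 := by positivity
  obtain ⟨L, hL, hαL⟩ := Metric.mem_closure_iff.1 hα (ε / 2 / (|R| + 1)) (by positivity)
  rw [dist_eq_norm, lt_div_iff₀ hR] at hαL
  filter_upwards [Metric.tendsto_nhds.1 (hS L hL) (ε / 2) (half_pos hε)] with i hi
  rw [dist_zero_right] at hi ⊢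
  have hdiff : ‖(α - L) (w i)‖ ≤ ‖α - L‖ * (|R| + 1) :=
    (α - L).le_opNorm_of_le ((hw i).trans ((le_abs_self R).trans (by linarith)))
  calc ‖α (w i)‖ = ‖(α - L) (w i) + L (w i)‖ := by rw [sub_apply, sub_add_cancel]
    _ ≤ ‖(α - L) (w i)‖ + ‖L (w i)‖ := norm_add_le _ _
    _ < ε := by linarith

lemma indicator_iUnion_eq_sum {α ι M : Type*} [Fintype ι] [AddCommMonoid M] {s : ι → Set α}
    {x : α} (hx : Pairwise fun i j => x ∉ s i ∩ s j) (f : α → M) :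
    (⋃ i, s i).indicator f x = ∑ i, (s i).indicator f x := by
  by_cases hxu : x ∈ ⋃ i, s i
  · obtain ⟨i, hi⟩ := Set.mem_iUnion.1 hxu
    rw [Set.indicator_of_mem hxu, Finset.sum_eq_single i (fun j _ hji => ?_) (by simp),
      Set.indicator_of_mem hi]
    exact Set.indicator_of_notMem (fun hj => hx hji ⟨hj, hi⟩) _
  · rw [Set.indicator_of_notMem hxu]
    refine (Finset.sum_eq_zero fun i _ => ?_).symm
    exact Set.indicator_of_notMem (fun hi => hxu (Set.mem_iUnion.2 ⟨i, hi⟩)) _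

section Charges

variable {d : ℕ}

lemma BVSet.coeFn_ind (B : BVSet d) :
    B.ind.toL1 =ᵐ[volume] B.carrier.indicator fun _ => (1 : ℝ) :=
  (memLp_one_iff_integrable.2
    (integrable_indicator B.subset_cube B.nullMeasurableSet)).coeFn_toLp

lemma BVSet.ind_eq_add {B₁ B₂ B : BVSet d} (h : volume (B₁.carrier ∩ B₂.carrier) = 0)
    (hB : B.carrier = B₁.carrier ∪ B₂.carrier) : B.ind = B₁.ind + B₂.ind := by
  refine BV.toL1_injective (Lp.ext ?_)
  rw [map_add]
  filter_upwards [B.coeFn_ind, B₁.coeFn_ind, B₂.coeFn_ind, Lp.coeFn_add B₁.ind.toL1 B₂.ind.toL1,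
    measure_eq_zero_iff_ae_notMem.1 h] with x hB' h₁ h₂ hadd hx
  rw [hadd, Pi.add_apply, hB', h₁, h₂, hB, Set.indicator_union_of_notMem_inter hx]

lemma BVSet.ind_figure {n : ℕ} (K : Fin n → Rect d)
    (hK : Pairwise fun i j => volume ((K i).toSet ∩ (K j).toSet) = 0) :
    (figure K hK).ind = ∑ i, (K i).toBVSet.ind := by
  refine BV.toL1_injective (Lp.ext ?_)
  rw [map_sum]
  have hdisj : ∀ᵐ x : Space d, Pairwise fun i j => x ∉ (K i).toSet ∩ (K j).toSet := by
    simp only [Pairwise, ae_all_iff]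
    exact fun i j hij => measure_eq_zero_iff_ae_notMem.1 (hK hij)
  filter_upwards [hdisj, ae_all_iff.2 fun i => (K i).toBVSet.coeFn_ind,
    Lp.coeFn_finsetSum Finset.univ fun i => (K i).toBVSet.ind.toL1,
    (figure K hK).coeFn_ind] with x hx hrect hsum hfig
  simp only [hfig, hsum, Finset.sum_apply, hrect]
  exact indicator_iUnion_eq_sum hx _

lemma BVSet.norm_toL1_ind_sub (B₁ B₂ : BVSet d) :
    ‖(B₁.ind - B₂.ind).toL1‖ = volume.real (B₁.carrier ∆ B₂.carrier) := by
  have hsub : ∀ᵐ x, ‖(B₁.ind.toL1 - B₂.ind.toL1) x‖ =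
      ‖(B₁.carrier ∆ B₂.carrier).indicator (fun _ => (1 : ℝ)) x‖ := by
    filter_upwards [B₁.coeFn_ind, B₂.coeFn_ind, Lp.coeFn_sub B₁.ind.toL1 B₂.ind.toL1]
      with x h₁ h₂ hx
    rw [hx, Pi.sub_apply, h₁, h₂, Set.apply_indicator_symmDiff norm_neg]
  have hm : NullMeasurableSet (B₁.carrier ∆ B₂.carrier) volume :=
    B₁.nullMeasurableSet.symmDiff B₂.nullMeasurableSet
  rw [map_sub, Lp.norm_def, eLpNorm_congr_norm_ae hsub, eLpNorm_indicator_const₀ hm one_ne_zero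
    ENNReal.one_ne_top]
  simp [measureReal_def]

lemma BVSet.norm_ind (B : BVSet d) :
    ‖B.ind‖ = volume.real B.carrier + (perimeter B.carrier).toReal := by
  rw [BV.norm_def, variation_congr B.coeFn_ind, perimeter, Lp.norm_def,
    eLpNorm_congr_ae B.coeFn_ind, eLpNorm_indicator_const₀ B.nullMeasurableSet one_ne_zero
      ENNReal.one_ne_top]
  simp [measureReal_def]

lemma BVSet.norm_ind_le_of_perimeter_le {B : BVSet d} {p : ℝ≥0∞} (hp : p ≠ ∞)
    (hB : perimeter B.carrier ≤ p) : ‖B.ind‖ ≤ volume.real (cube d) + p.toReal := by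
  rw [B.norm_ind]
  exact add_le_add (measureReal_mono B.subset_cube (volume_cube_lt_top d).ne)
    (ENNReal.toReal_mono hp hB)

lemma isCharge_of_mem_closure {α : StrongDual ℝ (BV d)}
    (hα : α ∈ closure (Set.range fun L : StrongDual ℝ (Lp ℝ 1 (volume : Measure (Space d))) =>
      L.comp BV.toL1CLM)) :
    IsCharge fun B : BVSet d => α B.ind := by
  refine ⟨fun B₁ B₂ B h hB => by rw [BVSet.ind_eq_add h hB, map_add], fun B B' hB hlim => ?_⟩
  have hbound : ∀ n, ‖(B n).ind - B'.ind‖ ≤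
      volume.real (cube d) + (⨆ n, perimeter (B n).carrier).toReal + ‖B'.ind‖ := fun n =>
    (norm_sub_le _ _).trans (add_le_add_left (BVSet.norm_ind_le_of_perimeter_le hB.ne
      (le_iSup (fun n => perimeter (B n).carrier) n)) _)
  have hL1 : Tendsto (fun n => ((B n).ind - B'.ind).toL1) atTop (𝓝 0) := by
    rw [tendsto_zero_iff_norm_tendsto_zero]
    simp only [BVSet.norm_toL1_ind_sub]
    exact (ENNReal.tendsto_toReal ENNReal.zero_ne_top).comp hlim
  rw [← tendsto_sub_nhds_zero_iff]
  simp only [← map_sub]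
  refine tendsto_apply_zero_of_mem_closure hbound ?_ hα
  rintro _ ⟨L, rfl⟩
  exact (map_zero L) ▸ (L.continuous.tendsto 0).comp hL1

end Charges

section Perimeter

variable {n : ℕ}

lemma setIntegral_divergence_box {a b : Fin (n + 1) → ℝ} (hab : a ≤ b)
    {φ : Space (n + 1) → Space (n + 1)} (hφ : ContDiff ℝ 1 φ) :
    ∫ y in Set.Icc a b, divergence φ (WithLp.toLp 2 y) =
      ∑ i, ((∫ y in Set.Icc (a ∘ i.succAbove) (b ∘ i.succAbove),
          φ (WithLp.toLp 2 (i.insertNth (b i) y)) i) -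
        ∫ y in Set.Icc (a ∘ i.succAbove) (b ∘ i.succAbove),
          φ (WithLp.toLp 2 (i.insertNth (a i) y)) i) := by
  let e : (Fin (n + 1) → ℝ) →L[ℝ] Space (n + 1) :=
    ((EuclideanSpace.equiv (Fin (n + 1)) ℝ).symm : (Fin (n + 1) → ℝ) →L[ℝ] Space (n + 1))
  let π : Fin (n + 1) → Space (n + 1) →L[ℝ] ℝ := EuclideanSpace.proj
  have hφc : Continuous φ := hφ.continuous
  have hφ' : Continuous (fderiv ℝ φ) := hφ.continuous_fderiv one_ne_zero
  have hdiv : Continuous fun y => divergence φ (e y) :=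
    continuous_finsetSum _ fun i _ => (π i).continuous.comp
      ((hφ'.comp e.continuous).clm_apply continuous_const)
  exact integral_divergence_of_hasFDerivAt_off_countable' a b hab (fun i y => φ (e y) i)
    (fun i y => ((π i).comp (fderiv ℝ φ (e y))).comp e) ∅ Set.countable_empty
    (fun i => ((π i).continuous.comp (hφc.comp e.continuous)).continuousOn)
    (fun y _ i => (π i).hasFDerivAt.comp y
      ((hφ.differentiable one_ne_zero (e y)).hasFDerivAt.comp y e.hasFDerivAt))
    (hdiv.continuousOn.integrableOn_compact isCompact_Icc)

lemma IsTestField.setIntegral_divergence_box_le {a b : Fin (n + 1) → ℝ} (hab : a ≤ b)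
    {φ : Space (n + 1) → Space (n + 1)} (hφ : IsTestField φ) :
    ∫ y in Set.Icc a b, divergence φ (WithLp.toLp 2 y) ≤
      ∑ i : Fin (n + 1), 2 * ∏ j, (b (i.succAbove j) - a (i.succAbove j)) := by
  rw [setIntegral_divergence_box hab hφ.contDiff]
  refine Finset.sum_le_sum fun i _ => ?_
  have hface : ∀ t : ℝ, |∫ y in Set.Icc (a ∘ i.succAbove) (b ∘ i.succAbove),
      φ (WithLp.toLp 2 (i.insertNth t y)) i| ≤ ∏ j, (b (i.succAbove j) - a (i.succAbove j)) := by
    intro t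
    have hvol := Real.volume_Icc_pi_toReal
      (show a ∘ i.succAbove ≤ b ∘ i.succAbove from fun j => hab _)
    refine (norm_setIntegral_le_of_norm_le_const (C := 1) isCompact_Icc.measure_lt_top
      fun y _ => (PiLp.norm_apply_le _ i).trans (hφ.norm_le_one _)).trans_eq ?_
    rw [one_mul, measureReal_def, hvol]
    rfl
  rw [two_mul]
  exact (le_abs_self _).trans ((abs_sub _ _).trans (add_le_add (hface _) (hface _)))

lemma Rect.perimeter_le {d : ℕ} (K : Rect d) : perimeter K.toSet ≤ ENNReal.ofReal (2 * d) := by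
  rcases d with _ | n
  · simp [perimeter, variation, divergence]
  refine iSup₂_le fun φ hφ => ENNReal.ofReal_le_ofReal ?_
  have hind : (fun x => K.toSet.indicator (fun _ => (1 : ℝ)) x * divergence φ x) =
      K.toSet.indicator (divergence φ) := by
    ext x
    by_cases hx : x ∈ K.toSet <;> simp [hx]
  have hside : ∀ i, 0 ≤ (K.hi i : ℝ) - K.lo i ∧ (K.hi i : ℝ) - K.lo i ≤ 1 := fun i =>
    ⟨sub_nonneg.2 (K.lo_lt_hi i).le, by linarith [(K.hi i).2.2, (K.lo i).2.1]⟩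
  rw [hind, integral_indicator K.measurableSet, K.toSet_eq_preimage]
  calc ∫ x in WithLp.ofLp ⁻¹' Set.Icc (fun i => (K.lo i : ℝ)) fun i => (K.hi i : ℝ),
        divergence φ x =
      ∫ y in Set.Icc (fun i => (K.lo i : ℝ)) fun i => (K.hi i : ℝ),
        divergence φ (WithLp.toLp 2 y) :=
      (PiLp.volume_preserving_ofLp (Fin (n + 1))).setIntegral_preimage_emb
        (MeasurableEquiv.toLp 2 (Fin (n + 1) → ℝ)).symm.measurableEmbedding
        (fun y => divergence φ (WithLp.toLp 2 y)) _
    _ ≤ ∑ i : Fin (n + 1), 2 * ∏ j, ((K.hi (i.succAbove j) : ℝ) - K.lo (i.succAbove j)) :=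
      hφ.setIntegral_divergence_box_le fun i => (K.lo_lt_hi i).le
    _ ≤ ∑ _i : Fin (n + 1), 2 * 1 := by
      gcongr
      exact Finset.prod_le_one (fun j _ => (hside _).1) fun j _ => (hside _).2
    _ = 2 * (n + 1 : ℕ) := by simp [mul_comm]

end Perimeter

section Chargeability

variable {d : ℕ} {f : (Fin d → unitInterval) → ℝ}

lemma dyadicFunctional_ind (f : (Fin d → unitInterval) → ℝ) {n : ℕ} {K : Rect d}
    (hK : K.IsDyadic n) : dyadicFunctional f n K.toBVSet.ind = increment f K := by
  rw [dyadicFunctional_apply, ← setIntegral_dyadicDensity f hK,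
    ← integral_indicator K.measurableSet]
  refine integral_congr_ae ?_
  filter_upwards [K.toBVSet.coeFn_ind] with x hx
  rw [hx]
  by_cases hxK : x ∈ K.toSet <;> simp [Rect.toBVSet, hxK]

section Limit

variable {α : StrongDual ℝ (BV d)} (hα : Tendsto (dyadicFunctional f) atTop (𝓝 α))

include hα

lemma mem_SCH_of_tendsto_dyadicFunctional : α ∈ SCH d :=
  mem_closure_of_tendsto hα (Eventually.of_forall fun _ => integralFunctional_mem_rangeT _)

lemma isCharge_of_tendsto_dyadicFunctional : IsCharge fun B : BVSet d => α B.ind :=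
  isCharge_of_mem_closure
    (mem_closure_of_tendsto hα (Eventually.of_forall fun _ => ⟨_, rfl⟩))

lemma Rect.IsDyadic.apply_ind_eq_increment {n : ℕ} {K : Rect d} (hK : K.IsDyadic n) :
    α K.toBVSet.ind = increment f K := by
  refine tendsto_nhds_unique (((ContinuousLinearMap.apply ℝ ℝ K.toBVSet.ind).continuous.tendsto
    α).comp hα) (tendsto_const_nhds.congr' ?_)
  filter_upwards [eventually_ge_atTop n] with m hm
  exact (dyadicFunctional_ind f (hK.mono hm)).symm

lemma apply_ind_eq_increment (hf : Continuous f) (K : Rect d) :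
    α K.toBVSet.ind = increment f K := by
  have hcharge : Tendsto (fun n => α (K.dyadicHull n).toBVSet.ind) atTop
      (𝓝 (α K.toBVSet.ind)) :=
    (isCharge_of_tendsto_dyadicFunctional hα).continuous (fun n => (K.dyadicHull n).toBVSet) _
      ((iSup_le fun n => (K.dyadicHull n).perimeter_le).trans_lt ENNReal.ofReal_lt_top)
      K.tendsto_volume_symmDiff_dyadicHull
  refine tendsto_nhds_unique (hcharge.congr fun n => ?_) (tendsto_increment_dyadicHull hf K)
  exact (K.isDyadic_dyadicHull n).apply_ind_eq_increment hα

lemma extendsIncrement_of_tendsto_dyadicFunctional (hf : Continuous f) :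
    ExtendsIncrement (fun B => α B.ind) f := fun n K hK => by
  simp only [BVSet.ind_figure, map_sum, apply_ind_eq_increment hα hf]

end Limit

lemma two_pow_mul_rpow_lt_two (hd : 1 ≤ d) {γ : ℝ} (hγ : ((d : ℝ) - 1) / d < γ) :
    2 ^ d * ((2 ^ d)⁻¹ : ℝ) ^ γ < 2 := by
  have hd' : (0 : ℝ) < d := by exact_mod_cast hd
  rw [div_lt_iff₀ hd'] at hγ
  calc 2 ^ d * ((2 ^ d)⁻¹ : ℝ) ^ γ = 2 ^ ((d : ℝ) * (1 - γ)) := by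
        rw [Real.inv_rpow (by positivity), ← Real.rpow_natCast, ← Real.rpow_mul two_pos.le,
          ← Real.rpow_neg two_pos.le, ← Real.rpow_add two_pos]
        ring_nf
    _ < 2 ^ (1 : ℝ) := Real.rpow_lt_rpow_of_exponent_lt one_lt_two (by linarith)
    _ = 2 := Real.rpow_one 2

theorem isHolderStronglyChargeable_of_increment_le (hd : 1 ≤ d) (hf : Continuous f) {γ c : ℝ}
    (hγ : ((d : ℝ) - 1) / d < γ) (hc : 0 ≤ c)
    (h : ∀ n (k : Fin d → Fin (2 ^ n)),
      |increment f (dyadicCube n k)| ≤ c * (dyadicCube n k).vol ^ γ) :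
    IsHolderStronglyChargeable γ f := by
  have hcauchy : CauchySeq (dyadicFunctional f) :=
    cauchySeq_dyadicFunctional (two_pow_mul_rpow_lt_two hd hγ) fun n k => by
      rw [Real.rpow_pow_comm (by positivity), ← vol_dyadicCube n k]
      exact h n k
  obtain ⟨α, hα⟩ := cauchySeq_tendsto_of_complete hcauchy
  refine ⟨fun B => α B.ind, ⟨isCharge_of_tendsto_dyadicFunctional hα, α,
    mem_SCH_of_tendsto_dyadicFunctional hα, fun _ => rfl⟩,
    extendsIncrement_of_tendsto_dyadicFunctional hα hf, c, hc, fun n k => ?_⟩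
  exact (congrArg abs (apply_ind_eq_increment hα hf _)).trans_le (h n k)

end Chargeability

section Moments

variable {Ω : Type*} [MeasurableSpace Ω] {P : Measure Ω} {d : ℕ}

lemma ae_exists_forall_norm_le_mul {ι E : Type*} [Countable ι] [SeminormedAddCommGroup E]
    {Y : ι → Ω → E} (hY : ∀ i, AEStronglyMeasurable (Y i) P) {b : ι → ℝ} (hb : ∀ i, 0 < b i)
    {q : ℝ} (hq : 0 < q)
    (h : ∑' i, ∫⁻ ω, ENNReal.ofReal ((‖Y i ω‖ / b i) ^ q) ∂P ≠ ∞) :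
    ∀ᵐ ω ∂P, ∃ c : ℝ, 0 ≤ c ∧ ∀ i, ‖Y i ω‖ ≤ c * b i := by
  have hm : ∀ i, AEMeasurable (fun ω => ENNReal.ofReal ((‖Y i ω‖ / b i) ^ q)) P := fun i =>
    (((hY i).norm.aemeasurable.div_const _).pow_const q).ennreal_ofReal
  rw [← lintegral_tsum hm] at h
  filter_upwards [ae_lt_top' (AEMeasurable.tsum hm) h] with ω hω
  refine ⟨(∑' i, ENNReal.ofReal ((‖Y i ω‖ / b i) ^ q)).toReal ^ q⁻¹, by positivity,
    fun i => (div_le_iff₀ (hb i)).1 ?_⟩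
  have hbi := (hb i).le
  rw [Real.le_rpow_inv_iff_of_pos (by positivity) ENNReal.toReal_nonneg hq,
    ← ENNReal.ofReal_le_iff_le_toReal hω.ne]
  exact ENNReal.le_tsum i

lemma summable_vol_dyadicCube_rpow (hd : 1 ≤ d) {η : ℝ} (hη : 0 < η) :
    Summable fun p : Σ n, Fin d → Fin (2 ^ n) => (dyadicCube p.1 p.2).vol ^ (1 + η) := by
  have hlevel : ∀ n, ∑' _ : Fin d → Fin (2 ^ n), (((2 ^ d : ℝ)⁻¹) ^ n) ^ (1 + η) =
      (((2 ^ d : ℝ)⁻¹) ^ η) ^ n := fun n => by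
    rw [tsum_fintype, Finset.sum_const, Finset.card_univ, Fintype.card_fun, Fintype.card_fin,
      Fintype.card_fin, nsmul_eq_mul, Real.rpow_add (by positivity), Real.rpow_one, ← mul_assoc,
      Real.rpow_pow_comm (by positivity)]
    push_cast
    rw [← pow_mul, mul_comm n d, pow_mul, inv_pow, mul_inv_cancel₀ (by positivity), one_mul]
  simp only [vol_dyadicCube]
  refine (summable_sigma_of_nonneg fun _ => by positivity).2
    ⟨fun _ => Summable.of_finite, ?_⟩
  simp only [hlevel]
  exact summable_geometric_of_lt_one (by positivity) (Real.rpow_lt_one (by positivity)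
    (inv_lt_one_of_one_lt₀ (one_lt_pow₀ one_lt_two (by lia))) hη)

lemma lintegral_div_rpow_le {Y : Ω → ℝ} {v γ q C δ : ℝ} (hv : 0 < v)
    (h : ∫⁻ ω, ENNReal.ofReal (|Y ω| ^ q) ∂P ≤ ENNReal.ofReal (C * v ^ (1 + δ))) :
    ∫⁻ ω, ENNReal.ofReal ((|Y ω| / v ^ γ) ^ q) ∂P ≤
      ENNReal.ofReal (C * v ^ (1 + (δ - γ * q))) := by
  have hpow : ∀ ω, (|Y ω| / v ^ γ) ^ q = |Y ω| ^ q * v ^ (-(γ * q)) := fun ω => by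
    rw [Real.div_rpow (abs_nonneg _) (by positivity), ← Real.rpow_mul hv.le, Real.rpow_neg hv.le,
      div_eq_mul_inv]
  simp only [hpow, ENNReal.ofReal_mul' (Real.rpow_nonneg hv.le (-(γ * q)))]
  rw [lintegral_mul_const' _ _ ENNReal.ofReal_ne_top]
  refine (mul_le_mul_left h _).trans_eq ?_
  rw [← ENNReal.ofReal_mul' (by positivity), mul_assoc, ← Real.rpow_add hv]
  ring_nf

lemma aemeasurable_increment {X : (Fin d → unitInterval) → Ω → ℝ}
    (hX : ∀ t, AEMeasurable (X t) P) (K : Rect d) :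
    AEMeasurable (fun ω => increment (fun t => X t ω) K) P :=
  Finset.aemeasurable_fun_sum _ fun _ _ => (hX _).const_mul _

lemma vol_dyadicCube_pos (n : ℕ) (k : Fin d → Fin (2 ^ n)) : 0 < (dyadicCube n k).vol := by
  rw [vol_dyadicCube]
  positivity

lemma vol_dyadicCube_le_one (n : ℕ) (k : Fin d → Fin (2 ^ n)) : (dyadicCube n k).vol ≤ 1 := by
  rw [vol_dyadicCube]
  exact pow_le_one₀ (by positivity) (inv_le_one_of_one_le₀ (one_le_pow₀ one_le_two))

theorem ae_exists_forall_abs_increment_le (hd : 1 ≤ d) {X : (Fin d → unitInterval) → Ω → ℝ}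
    (hX : ∀ t, AEMeasurable (X t) P) {q C δ γ : ℝ} (hq : 0 < q) (hγ : γ < δ / q)
    (hmoment : ∀ (n : ℕ) (k : Fin d → Fin (2 ^ n)),
      ∫⁻ ω, ENNReal.ofReal (|increment (fun t => X t ω) (dyadicCube n k)| ^ q) ∂P ≤
        ENNReal.ofReal (C * (dyadicCube n k).vol ^ (1 + δ))) :
    ∀ᵐ ω ∂P, ∃ c : ℝ, 0 ≤ c ∧ ∀ n (k : Fin d → Fin (2 ^ n)),
      |increment (fun t => X t ω) (dyadicCube n k)| ≤ c * (dyadicCube n k).vol ^ γ := by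
  have hη : 0 < δ - γ * q := sub_pos.2 ((lt_div_iff₀ hq).1 hγ)
  have hsum : ∑' p : Σ n, Fin d → Fin (2 ^ n), ∫⁻ ω, ENNReal.ofReal
      ((‖increment (fun t => X t ω) (dyadicCube p.1 p.2)‖ / (dyadicCube p.1 p.2).vol ^ γ) ^ q) ∂P
      ≠ ∞ :=
    ne_top_of_le_ne_top ((summable_vol_dyadicCube_rpow hd hη).mul_left C).tsum_ofReal_ne_top
      (ENNReal.tsum_le_tsum fun p =>
        lintegral_div_rpow_le (vol_dyadicCube_pos p.1 p.2) (hmoment p.1 p.2))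
  have hae := ae_exists_forall_norm_le_mul
    (fun p : Σ n, Fin d → Fin (2 ^ n) =>
      (aemeasurable_increment hX (dyadicCube p.1 p.2)).aestronglyMeasurable)
    (fun p => Real.rpow_pos_of_pos (vol_dyadicCube_pos p.1 p.2) γ) hq hsum
  filter_upwards [hae] with ω ⟨c, hc, hω⟩
  exact ⟨c, hc, fun n k => hω ⟨n, k⟩⟩

lemma abs_increment_le_of_exponent_le {f : (Fin d → unitInterval) → ℝ} {c γ γ' : ℝ} (hc : 0 ≤ c)
    (hγ : γ ≤ γ') {n : ℕ} {k : Fin d → Fin (2 ^ n)}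
    (h : |increment f (dyadicCube n k)| ≤ c * (dyadicCube n k).vol ^ γ') :
    |increment f (dyadicCube n k)| ≤ c * (dyadicCube n k).vol ^ γ :=
  h.trans (mul_le_mul_of_nonneg_left (Real.rpow_le_rpow_of_exponent_ge (vol_dyadicCube_pos n k)
    (vol_dyadicCube_le_one n k) hγ) hc)

theorem ae_forall_lt_exists_forall_abs_increment_le (hd : 1 ≤ d)
    {X : (Fin d → unitInterval) → Ω → ℝ} (hX : ∀ t, AEMeasurable (X t) P) {q C δ : ℝ} (hq : 0 < q)
    (hmoment : ∀ (n : ℕ) (k : Fin d → Fin (2 ^ n)),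
      ∫⁻ ω, ENNReal.ofReal (|increment (fun t => X t ω) (dyadicCube n k)| ^ q) ∂P ≤
        ENNReal.ofReal (C * (dyadicCube n k).vol ^ (1 + δ))) :
    ∀ᵐ ω ∂P, ∀ γ < δ / q, ∃ c : ℝ, 0 ≤ c ∧ ∀ n (k : Fin d → Fin (2 ^ n)),
      |increment (fun t => X t ω) (dyadicCube n k)| ≤ c * (dyadicCube n k).vol ^ γ := by
  have hae := ae_all_iff.2 fun m : ℕ => ae_exists_forall_abs_increment_le hd hX hq
    (sub_lt_self (δ / q) (by positivity : 0 < 1 / ((m : ℝ) + 1))) hmoment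
  filter_upwards [hae] with ω hω γ hγ
  obtain ⟨m, hm⟩ := exists_nat_one_div_lt (sub_pos.2 hγ)
  obtain ⟨c, hc, hω⟩ := hω m
  exact ⟨c, hc, fun n k => abs_increment_le_of_exponent_le hc (by linarith) (hω n k)⟩

end Moments

end StrongCharge

end

theorem mainTheorem9_general {Ω : Type*} [MeasurableSpace Ω] (P : Measure Ω)
    (d : ℕ) (hd : 1 ≤ d)
    (X : (Fin d → unitInterval) → Ω → ℝ)
    (hX_meas : ∀ t, AEMeasurable (X t) P)
    (hX_cont : ∀ᵐ ω ∂P, Continuous fun t => X t ω)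
    (q C δ : ℝ) (hq : 0 < q)
    (hmoment : ∀ (n : ℕ) (k : Fin d → Fin (2 ^ n)),
      ∫⁻ ω, ENNReal.ofReal (|increment (fun t => X t ω) (dyadicCube n k)| ^ q) ∂P ≤
        ENNReal.ofReal (C * (dyadicCube n k).vol ^ (1 + δ))) :
    ∀ᵐ ω ∂P, ∀ γ : ℝ, ((d : ℝ) - 1) / d < γ → γ < δ / q →
      IsHolderStronglyChargeable γ fun t => X t ω := by
  filter_upwards [hX_cont, ae_forall_lt_exists_forall_abs_increment_le hd hX_meas hq hmoment]
    with ω hcont hbound γ hlow hup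
  obtain ⟨c, hc, hincrement⟩ := hbound γ hup
  exact isHolderStronglyChargeable_of_increment_le hd hcont hlow hc hincrement

theorem mainTheorem9 {Ω : Type*} [MeasurableSpace Ω] (P : Measure Ω) [IsProbabilityMeasure P]
    (d : ℕ) (hd : 1 ≤ d)
    (X : (Fin d → unitInterval) → Ω → ℝ)
    (hX_meas : ∀ t, Measurable (X t))
    (hX_cont : ∀ ω, Continuous fun t => X t ω)
    (q C δ : ℝ) (hq : 0 < q) (hC : 0 ≤ C) (hδ : 0 < δ)
    (hlow : ((d : ℝ) - 1) / d < δ / q) (hup : δ / q ≤ 1)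
    (hmoment : ∀ (n : ℕ) (k : Fin d → Fin (2 ^ n)),
      ∫⁻ ω, ENNReal.ofReal (|increment (fun t => X t ω) (dyadicCube n k)| ^ q) ∂P ≤
        ENNReal.ofReal (C * (dyadicCube n k).vol ^ (1 + δ))) :
    ∀ᵐ ω ∂P, ∀ γ : ℝ, ((d : ℝ) - 1) / d < γ → γ < δ / q →
      IsHolderStronglyChargeable γ fun t => X t ω :=
  mainTheorem9_general P d hd X (fun t => (hX_meas t).aemeasurable) (ae_of_all P hX_cont) q C δ hq
    hmoment
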